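/- Let $\Lambda=\{\lambda_i\}_{i=0}^{\infty}$ be a sequence of real numbers with $0=\lambda_0<\lambda_1<\lambda_2<\cdots$ and $\sum_{i=1}^{\infty}1/\lambda_i<\infty$, and let $s>0$. Let $M(\Lambda)=\operatorname{span}\{x^{\lambda_0},x^{\lambda_1},\dots\}$ be the set of all finite linear combinations with real coefficients of the functions $x^{\lambda_i}$ on $[0,\infty)$ (with $x^{\lambda_0}\equiv 1$), and for a set $B\subset[0,\infty)$ write $\|p\|_B:=\sup_{x\in B}|p(x)|$. Then there exists a constant $c$ depending only on $\Lambda$ and $s$ (and not on $\varrho$, $A$, $p$ or the number of terms of $p$) such that $$\|p\|_{[0,\varrho]}\le c\,\|p\|_A$$ for every $p\in M(\Lambda)$, every real number $\varrho\ge 0$ and every set $A\subset[\varrho,1]$ of Lebesgue measure at least $s$. -/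

import Mathlib

open MeasureTheory

/-- The Müntz space `M(Λ)`: finite real linear combinations of the functions `x ↦ x ^ (lam i)`.
It is used only at points `x ≥ 0`; the real power satisfies `0 ^ 0 = 1`, so `x ^ 0` is the
constant function `1`. -/
noncomputable def muntzSpace (lam : ℕ → ℝ) : Submodule ℝ (ℝ → ℝ) :=
  Submodule.span ℝ (Set.range fun i : ℕ => fun x : ℝ => x ^ lam i)

/-- The uniform norm of `p` on `A`, the supremum of `|p x|` over `x ∈ A`. It is used only for
nonempty `A` on which `p` is bounded. -/
noncomputable def supNormOn (p : ℝ → ℝ) (A : Set ℝ) : ℝ :=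
  sSup ((fun x => |p x|) '' A)

/-! Two mechanisms are combined. The first is monotonicity in the exponents. For nodes `x 0 < … < x
N` and `0 < y < x 0`, the value at `y` of a sum with `N + 1` given exponents is a fixed weighted sum
of its values at the nodes. Descartes' rule of signs shows that no weight grows in absolute value
when the exponents are raised (`IsWeights.abs_le_of_exp_le`). This is used twice. Comparison with
the exponents `c * i`, where the weights are those of Lagrange interpolation in `x ^ c`, gives a
Remez inequality whose constant depends on the number of terms (`abs_muntzSum_le_of_measure`).
Moreover, Hahn–Banach and Carathéodory turn any bound at `y` into a formula with `N + 1` nodes and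
small weights, so a bound for smaller exponents passes to Λ (`bound_of_exp_le`). Hence Λ may be
replaced by a minorant `g` that still has summable reciprocals and for which `g i / √i` is
nondecreasing (`exists_regular_minorant`).

The second mechanism removes the dependence on the number of terms by repeated halving. Suppose a
sum with `2 * n` terms is bounded by `b` on a set of measure `δ = K * n / g n` inside `(y', y'']`,
and put `R = (y'' - y') / δ`. Just to the left of `y'` the Remez inequality gives a bound `b * exp
(O(n R))`. The regularity of `g` then bounds the coefficients of index at least `n` by a quantity of
the same order. Moving left by `η * (y'' - y')` multiplies each of these terms by at most `exp (-η K
n R)`, which wins when `K` is large (`sum_upper_half_le`). So the upper half can be dropped at the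
cost of a factor `exp (-2n)`.

Going down from `2 ^ (r + M)` terms to `2 ^ r` (`exists_truncation`) uses up measure `∑ K * 2 ^ i /
g (2 ^ i)` over `i ≥ r`, which is small for large `r` by Cauchy condensation, and margins of total
length at most `s / 4`. What remains is a sum with `2 ^ r` terms, where `r` depends on `g` and `s`
only, bounded on a part of `A` of measure at least `s / 2`; the first Remez inequality finishes the
proof. The set `A` need not be measurable: only subadditivity of the outer measure enters. -/

/-! ### Generalized polynomials, Rolle's theorem and Descartes' rule of signs -/

/-- The generalized polynomial with coefficients `a` and real exponents `e`, with `n` terms. -/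
noncomputable def muntzSum (n : ℕ) (a e : ℕ → ℝ) (x : ℝ) : ℝ :=
  ∑ i ∈ Finset.range n, a i * x ^ e i

/-- Coefficients and exponents of the derivative of `x ^ (-e 0) * muntzSum n a e x`. -/
noncomputable def derivCoeff (a e : ℕ → ℝ) (i : ℕ) : ℝ := a (i + 1) * (e (i + 1) - e 0)

noncomputable def derivExp (e : ℕ → ℝ) (i : ℕ) : ℝ := e (i + 1) - e 0 - 1

lemma strictMono_derivExp {e : ℕ → ℝ} (he : StrictMono e) : StrictMono (derivExp e) := by
  intro i j hij
  have := he (Nat.succ_lt_succ hij)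
  simp only [derivExp]
  simp only [Nat.succ_eq_add_one] at this
  linarith

lemma muntzSum_sub_exp (n : ℕ) (a e : ℕ → ℝ) (c : ℝ) {x : ℝ} (hx : 0 < x) :
    muntzSum n a (fun i => e i - c) x = x ^ (-c) * muntzSum n a e x := by
  simp only [muntzSum, Finset.mul_sum]
  refine Finset.sum_congr rfl fun i _ => ?_
  rw [sub_eq_add_neg, Real.rpow_add hx]; ring

lemma hasDerivAt_muntzSum_sub_exp (n : ℕ) (a e : ℕ → ℝ) {x : ℝ} (hx : 0 < x) :
    HasDerivAt (muntzSum (n + 1) a (fun i => e i - e 0))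
      (muntzSum n (derivCoeff a e) (derivExp e) x) x := by
  have h : HasDerivAt (fun x : ℝ => ∑ i ∈ Finset.range (n + 1), a i * x ^ (e i - e 0))
      (∑ i ∈ Finset.range (n + 1), a i * ((e i - e 0) * x ^ (e i - e 0 - 1))) x :=
    HasDerivAt.fun_sum fun i _ => (Real.hasDerivAt_rpow_const (Or.inl hx.ne')).const_mul _
  have h2 : ∑ i ∈ Finset.range (n + 1), a i * ((e i - e 0) * x ^ (e i - e 0 - 1))
      = muntzSum n (derivCoeff a e) (derivExp e) x := by
    rw [Finset.sum_range_succ']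
    simp only [muntzSum, derivCoeff, derivExp, sub_self, zero_mul, mul_zero, add_zero]
    exact Finset.sum_congr rfl fun i _ => by ring
  rw [h2] at h
  exact h

/-- Rolle: division by `x ^ e 0` makes the lowest term constant, so differentiation removes one term
at the price of one zero. This drives the inductions on the number of terms. -/
lemma exists_deriv_zeros {n t : ℕ} {a e z : ℕ → ℝ}
    (hpos : ∀ i < n + 1, 0 < z i) (hz : ∀ i j, i < j → j < n + 1 → z i < z j)
    (hzero : ∀ i < n + 1, muntzSum (t + 1) a (fun i => e i - e 0) (z i) = 0) :
    ∃ w : ℕ → ℝ, (∀ i < n, z i < w i ∧ w i < z (i + 1)) ∧ (∀ i < n, 0 < w i) ∧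
      (∀ i j, i < j → j < n → w i < w j) ∧
      ∀ i < n, muntzSum t (derivCoeff a e) (derivExp e) (w i) = 0 := by
  have key : ∀ i, ∃ w, i < n → (z i < w ∧ w < z (i + 1)) ∧
      muntzSum t (derivCoeff a e) (derivExp e) w = 0 := by
    intro i
    by_cases hi : i < n
    · have h1 : z i < z (i + 1) := hz i (i + 1) (Nat.lt_succ_self i) (by omega)
      have h0 : 0 < z i := hpos i (by omega)
      obtain ⟨c, hc, hc'⟩ := exists_hasDerivAt_eq_zero (f := muntzSum (t + 1) a (fun i => e i - e 0))
        (f' := muntzSum t (derivCoeff a e) (derivExp e)) h1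
        (fun x hx => (hasDerivAt_muntzSum_sub_exp t a e
          (lt_of_lt_of_le h0 hx.1)).continuousAt.continuousWithinAt)
        (by rw [hzero i (by omega), hzero (i + 1) (by omega)])
        (fun x hx => hasDerivAt_muntzSum_sub_exp t a e (h0.trans hx.1))
      exact ⟨c, fun _ => ⟨⟨hc.1, hc.2⟩, hc'⟩⟩
    · exact ⟨0, fun h => absurd h hi⟩
  choose w hw using key
  refine ⟨w, fun i hi => (hw i hi).1, fun i hi => (hpos i (by omega)).trans (hw i hi).1.1,
    fun i j hij hj => ?_, fun i hi => (hw i hi).2⟩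
  have h2 := (hw i (by omega)).1.2
  have h3 := (hw j hj).1.1
  rcases Nat.lt_or_ge (i + 1) j with h | h
  · exact h2.trans ((hz (i + 1) j h (by omega)).trans h3)
  · obtain rfl : j = i + 1 := by omega
    exact h2.trans h3

/-- Descartes' rule: a generalized polynomial with `n` terms and `n` positive zeros vanishes. -/
lemma muntzSum_coeff_eq_zero (n : ℕ) : ∀ (a e z : ℕ → ℝ), StrictMono e → (∀ i < n, 0 < z i) →
    (∀ i j, i < j → j < n → z i < z j) → (∀ i < n, muntzSum n a e (z i) = 0) →
    ∀ i < n, a i = 0 := by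
  induction n with
  | zero => intro a e z _ _ _ _ i hi; omega
  | succ n ih =>
    intro a e z he hpos hz hzero
    have hzero' : ∀ i < n + 1, muntzSum (n + 1) a (fun i => e i - e 0) (z i) = 0 := by
      intro i hi
      rw [muntzSum_sub_exp _ _ _ _ (hpos i hi), hzero i hi, mul_zero]
    obtain ⟨w, -, hwpos, hwmono, hw0⟩ := exists_deriv_zeros hpos hz hzero'
    have h1 := ih (derivCoeff a e) (derivExp e) w (strictMono_derivExp he) hwpos hwmono hw0
    have h2 : ∀ i < n, a (i + 1) = 0 := by
      intro i hi
      have h := h1 i hi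
      rcases mul_eq_zero.1 h with h | h
      · exact h
      · have := he (Nat.succ_pos i)
        simp only [Nat.succ_eq_add_one] at this
        linarith
    have h3 : a 0 = 0 := by
      have h := hzero' 0 (Nat.succ_pos n)
      rw [muntzSum, Finset.sum_range_succ'] at h
      rw [Finset.sum_eq_zero (fun i hi => by rw [h2 i (Finset.mem_range.1 hi), zero_mul])] at h
      simpa using h
    intro i hi
    cases i with
    | zero => exact h3
    | succ i => exact h2 i (by omega)

lemma continuous_muntzSum_sub_exp (n : ℕ) (a : ℕ → ℝ) {e : ℕ → ℝ} (he : StrictMono e) :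
    Continuous (muntzSum n a (fun i => e i - e 0)) := by
  unfold muntzSum
  refine continuous_finsetSum _ fun i _ => continuous_const.mul ?_
  exact Real.continuous_rpow_const (sub_nonneg.2 (he.monotone (Nat.zero_le i)))

/-- Signs of a generalized polynomial with `n + 1` terms and `n` positive zeros. -/
lemma muntzSum_sign (n : ℕ) : ∀ (a e z : ℕ → ℝ), StrictMono e → (∀ i < n, 0 < z i) →
    (∀ i j, i < j → j < n → z i < z j) → (∀ i < n, muntzSum (n + 1) a e (z i) = 0) → 0 < a 0 →
    (∀ i ≤ n, 0 < (-1) ^ i * a i) ∧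
    ∀ x, 0 < x → ∀ m ≤ n, (∀ i < m, z i < x) → (∀ i, m ≤ i → i < n → x < z i) →
      0 < (-1) ^ m * muntzSum (n + 1) a e x := by
  induction n with
  | zero =>
    intro a e z he _ _ _ ha
    refine ⟨fun i hi => ?_, fun x hx m hm _ _ => ?_⟩
    · obtain rfl : i = 0 := by omega
      simpa using ha
    · obtain rfl : m = 0 := by omega
      simpa [muntzSum] using mul_pos ha (Real.rpow_pos_of_pos hx _)
  | succ n ih =>
    intro a e z he hpos hz hzero ha
    set h := muntzSum (n + 2) a (fun i => e i - e 0) with hdef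
    set h' := muntzSum (n + 1) (derivCoeff a e) (derivExp e) with h'def
    have hder : ∀ x, 0 < x → HasDerivAt h (h' x) x := fun x hx =>
      hasDerivAt_muntzSum_sub_exp (n + 1) a e hx
    have hcont : Continuous h := continuous_muntzSum_sub_exp (n + 2) a he
    have hzero' : ∀ i < n + 1, h (z i) = 0 := by
      intro i hi
      rw [hdef, muntzSum_sub_exp _ _ _ _ (hpos i hi), hzero i hi, mul_zero]
    have h0 : h 0 = a 0 := by
      rw [hdef, muntzSum, Finset.sum_range_succ', Finset.sum_eq_zero]
      · simp
      · intro i _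
        have : e (i + 1) - e 0 ≠ 0 := (sub_pos.2 (he (Nat.succ_pos i))).ne'
        rw [Real.zero_rpow this, mul_zero]
    obtain ⟨w, hw, hwpos, hwmono, hw0⟩ := exists_deriv_zeros (n := n) hpos hz hzero'
    have hz0 : 0 < z 0 := hpos 0 (Nat.succ_pos n)
    -- negativity of the next coefficient
    have hneg : derivCoeff a e 0 < 0 := by
      by_contra hcon
      -- Since `h` falls from `a 0 > 0` at `0` to `0` at `z 0`, its derivative is negative somewhere
      -- to the left of every `w i`. A zero leading coefficient would make `h'` vanish identically,
      -- and a positive one would make it positive there.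
      rcases (not_lt.1 hcon).eq_or_lt with h1 | h1
      · -- the derivative has only `n` effective terms
        have hshift : ∀ x, h' x =
            muntzSum n (fun i => derivCoeff a e (i + 1)) (fun i => derivExp e (i + 1)) x := by
          intro x
          rw [h'def, muntzSum, Finset.sum_range_succ', ← h1, zero_mul, add_zero]
          rfl
        have h2 := muntzSum_coeff_eq_zero n (fun i => derivCoeff a e (i + 1))
          (fun i => derivExp e (i + 1)) w
          (fun i j hij => strictMono_derivExp he (Nat.succ_lt_succ hij)) hwpos hwmono
          (fun i hi => by rw [← hshift]; exact hw0 i hi)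
        have h3 : ∀ x, h' x = 0 := by
          intro x
          rw [hshift, muntzSum]
          refine Finset.sum_eq_zero fun i hi => ?_
          rw [h2 i (Finset.mem_range.1 hi), zero_mul]
        obtain ⟨c, hc, hc'⟩ := exists_hasDerivAt_eq_slope h h' hz0 hcont.continuousOn
          (fun x hx => hder x hx.1)
        rw [h3, hzero' 0 (Nat.succ_pos n), h0] at hc'
        have : (0 : ℝ) - a 0 = 0 := by
          rcases div_eq_zero_iff.1 hc'.symm with h | h
          · exact h
          · linarith
        linarith
      · have h2 := (ih _ _ w (strictMono_derivExp he) hwpos hwmono hw0 h1).2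
        obtain ⟨c, hc, hc'⟩ := exists_hasDerivAt_eq_slope h h' hz0 hcont.continuousOn
          (fun x hx => hder x hx.1)
        have h3 := h2 c hc.1 0 (Nat.zero_le _) (fun i hi => absurd hi (Nat.not_lt_zero i))
          (fun i _ hi => hc.2.trans (by
              rcases Nat.eq_zero_or_pos i with h | h
              · subst h; exact (hw 0 hi).1
              · exact (hz 0 i h (by omega)).trans (hw i hi).1))
        rw [hzero' 0 (Nat.succ_pos n), h0] at hc'
        have h4 : (0 - a 0) / (z 0 - 0) < 0 := div_neg_of_neg_of_pos (by linarith) (by linarith)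
        rw [← hc'] at h4
        simp only [pow_zero, one_mul] at h3
        exact lt_asymm h3 h4
    have hnegsum : ∀ x, muntzSum (n + 1) (fun i => -derivCoeff a e i) (derivExp e) x = -h' x := by
      intro x
      simp [h'def, muntzSum]
    obtain ⟨hs1, hs2⟩ := ih (fun i => -derivCoeff a e i) (derivExp e) w (strictMono_derivExp he)
      hwpos hwmono (fun i hi => by rw [hnegsum, h'def, hw0 i hi, neg_zero]) (by simpa using hneg)
    refine ⟨fun i hi => ?_, ?_⟩
    · cases i with
      | zero => simpa using ha
      | succ i =>
        have h1 := hs1 i (by omega)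
        have h2 : 0 < e (i + 1) - e 0 := sub_pos.2 (he (Nat.succ_pos i))
        simp only [derivCoeff] at h1
        have h3 : (-1 : ℝ) ^ i * -(a (i + 1) * (e (i + 1) - e 0))
          = ((-1) ^ (i + 1) * a (i + 1)) * (e (i + 1) - e 0) := by ring
        rw [h3] at h1
        exact pos_of_mul_pos_left h1 h2.le
    · intro x hx m hm hlt hgt
      suffices hh : 0 < (-1) ^ m * h x by
        rw [hdef, muntzSum_sub_exp _ _ _ _ hx] at hh
        have h3 : (-1 : ℝ) ^ m * (x ^ (-e 0) * muntzSum (n + 2) a e x)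
          = ((-1) ^ m * muntzSum (n + 2) a e x) * x ^ (-e 0) := by ring
        rw [h3] at hh
        exact pos_of_mul_pos_left hh (Real.rpow_pos_of_pos hx _).le
      -- comparison with a zero on the left or on the right
      by_cases hcase : m < n + 1 ∧ ∀ i < m, i < n → w i ≤ x
      · obtain ⟨hmn, hwx⟩ := hcase
        have hxz : x < z m := hgt m le_rfl hmn
        obtain ⟨c, hc, hc'⟩ := exists_hasDerivAt_eq_slope h h' hxz hcont.continuousOn
          (fun t ht => hder t (hx.trans ht.1))
        -- Exactly the zeros `w i` with `i < m` lie to the left of `c`, so the induction hypothesis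
        -- gives the sign of the slope of `h` between `x` and its zero `z m`.
        have h3 := hs2 c (hx.trans hc.1) m (by omega)
          (fun i hi => (hwx i hi (by omega)).trans_lt hc.1)
          (fun i hmi hi => hc.2.trans (lt_of_le_of_lt
            (by
              rcases hmi.eq_or_lt with h | h
              · rw [h]
              · exact (hz m i h (by omega)).le) (hw i hi).1))
        rw [hnegsum, hc', hzero' m hmn] at h3
        have h4 : 0 < z m - x := sub_pos.2 hxz
        have h5 : (-1 : ℝ) ^ m * -((0 - h x) / (z m - x)) = ((-1) ^ m * h x) / (z m - x) := by ring
        rw [h5] at h3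
        exact (div_pos_iff_of_pos_right h4).1 h3
      · have hm1 : ∃ k, m = k + 1 := by
          rcases Nat.eq_zero_or_pos m with h | h
          · exact absurd ⟨by omega, fun i hi => by omega⟩ hcase
          · exact ⟨m - 1, by omega⟩
        obtain ⟨k, rfl⟩ := hm1
        have hzx : z k < x := hlt k (Nat.lt_succ_self k)
        obtain ⟨c, hc, hc'⟩ := exists_hasDerivAt_eq_slope h h' hzx hcont.continuousOn
          (fun t ht => hder t ((hpos k (by omega)).trans ht.1))
        have hwk : k < n → x ≤ w k := by
          intro hkn
          by_contra hlt'
          refine hcase ⟨by omega, fun i hi hin => ?_⟩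
          rcases Nat.lt_or_ge i k with h | h
          · exact ((hwmono i k h hkn).trans (not_le.1 hlt')).le
          · obtain rfl : i = k := by omega
            exact (not_le.1 hlt').le
        have h3 := hs2 c ((hpos k (by omega)).trans hc.1) k (by omega)
          (fun i hi => ((hw i (by omega)).2.trans_le (by
            rcases Nat.lt_or_ge (i + 1) k with h | h
            · exact (hz (i + 1) k h (by omega)).le
            · obtain rfl : k = i + 1 := by omega
              exact le_rfl)).trans hc.1)
          (fun i hki hi => hc.2.trans_le ((hwk (by omega)).trans (by
            rcases hki.eq_or_lt with h | h
            · rw [h]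
            · exact (hwmono k i h hi).le)))
        rw [hnegsum, hc', hzero' k (by omega)] at h3
        have h4 : 0 < x - z k := sub_pos.2 hzx
        have h5 : (-1 : ℝ) ^ k * -((h x - 0) / (x - z k))
          = ((-1) ^ (k + 1) * h x) / (x - z k) := by ring
        rw [h5] at h3
        exact (div_pos_iff_of_pos_right h4).1 h3

lemma muntzSum_neg (n : ℕ) (a e : ℕ → ℝ) (x : ℝ) :
    muntzSum n (fun i => -a i) e x = -muntzSum n a e x := by
  simp [muntzSum]

lemma muntzSum_sub (n : ℕ) (a b e : ℕ → ℝ) (x : ℝ) :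
    muntzSum n (fun i => a i - b i) e x = muntzSum n a e x - muntzSum n b e x := by
  simp [muntzSum, sub_mul]

/-- Signs of a nonzero generalized polynomial with the maximal number of positive zeros. -/
lemma muntzSum_sign_of_ne_zero {n : ℕ} {a e z : ℕ → ℝ} (he : StrictMono e)
    (hpos : ∀ i < n, 0 < z i) (hz : ∀ i j, i < j → j < n → z i < z j)
    (hzero : ∀ i < n, muntzSum (n + 1) a e (z i) = 0) (hne : ∃ i ≤ n, a i ≠ 0) :
    (∀ i ≤ n, 0 < (-1) ^ i * a i * a 0) ∧
    ∀ x, 0 < x → ∀ m ≤ n, (∀ i < m, z i < x) → (∀ i, m ≤ i → i < n → x < z i) →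
      0 < (-1) ^ m * muntzSum (n + 1) a e x * a 0 := by
  rcases lt_trichotomy (a 0) 0 with h | h | h
  · obtain ⟨h1, h2⟩ := muntzSum_sign n (fun i => -a i) e z he hpos hz
      (fun i hi => by rw [muntzSum_neg, hzero i hi, neg_zero]) (by simpa using h)
    refine ⟨fun i hi => ?_, fun x hx m hm hl hr => ?_⟩
    · have := mul_pos (h1 i hi) (neg_pos.2 h)
      nlinarith
    · have := mul_pos (h2 x hx m hm hl hr) (neg_pos.2 h)
      rw [muntzSum_neg] at this
      nlinarith
  -- If `a 0 = 0`, only `n` terms remain for `n` zeros, and all coefficients vanish.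
  · exfalso
    have hshift : ∀ x, muntzSum (n + 1) a e x =
        muntzSum n (fun i => a (i + 1)) (fun i => e (i + 1)) x := by
      intro x
      rw [muntzSum, Finset.sum_range_succ', h, zero_mul, add_zero]
      rfl
    have h1 := muntzSum_coeff_eq_zero n (fun i => a (i + 1)) (fun i => e (i + 1)) z
      (fun i j hij => he (Nat.succ_lt_succ hij)) hpos hz
      (fun i hi => by rw [← hshift, hzero i hi])
    obtain ⟨i, hi, hai⟩ := hne
    cases i with
    | zero => exact hai h
    | succ i => exact hai (h1 i (by omega))
  · obtain ⟨h1, h2⟩ := muntzSum_sign n a e z he hpos hz hzero h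
    exact ⟨fun i hi => mul_pos (h1 i hi) h,
      fun x hx m hm hl hr => mul_pos (h2 x hx m hm hl hr) h⟩

/-! ### Fundamental functions of interpolation and their dependence on the exponents -/

/-- The increasing enumeration of `ℕ \ {k}`. -/
def skipAt (k i : ℕ) : ℕ := if i < k then i else i + 1

lemma strictMono_skipAt (k : ℕ) : StrictMono (skipAt k) := by
  intro i j hij
  simp only [skipAt]
  split_ifs <;> omega

lemma skipAt_ne (k i : ℕ) : skipAt k i ≠ k := by
  simp only [skipAt]
  split_ifs <;> omega

lemma skipAt_le {k i n : ℕ} (h : i < n) : skipAt k i ≤ n := by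
  simp only [skipAt]
  split_ifs <;> omega

/-- The sequence `a` with a zero inserted at place `k`. -/
def insertZero (k : ℕ) (a : ℕ → ℝ) (i : ℕ) : ℝ :=
  if i < k then a i else if i = k then 0 else a (i - 1)

lemma muntzSum_insertZero {n k : ℕ} (hk : k ≤ n) (a f : ℕ → ℝ) (x : ℝ) :
    muntzSum (n + 1) (insertZero k a) f x = muntzSum n a (f ∘ skipAt k) x := by
  induction n, hk using Nat.le_induction with
  | base =>
    rw [muntzSum, Finset.sum_range_succ]
    simp only [insertZero, lt_irrefl, if_false, if_true, zero_mul, add_zero, muntzSum]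
    refine Finset.sum_congr rfl fun i hi => ?_
    have := Finset.mem_range.1 hi
    simp [skipAt, this]
  | succ n hn ih =>
    have h1 : muntzSum (n + 1 + 1) (insertZero k a) f x = muntzSum (n + 1) (insertZero k a) f x
        + insertZero k a (n + 1) * x ^ f (n + 1) := Finset.sum_range_succ _ _
    have h2 : muntzSum (n + 1) a (f ∘ skipAt k) x = muntzSum n a (f ∘ skipAt k) x
        + a n * x ^ (f ∘ skipAt k) n := Finset.sum_range_succ _ _
    have h3 : insertZero k a (n + 1) = a n := by
      simp only [insertZero]
      rw [if_neg (by omega), if_neg (by omega)]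
      rfl
    have h4 : (f ∘ skipAt k) n = f (n + 1) := by
      simp only [Function.comp, skipAt]
      rw [if_neg (by omega)]
    rw [h1, h2, ih, h3, h4]

/-- Signs of the fundamental functions of interpolation. -/
lemma lagrange_sign {N j : ℕ} (hj : j ≤ N) {a e x : ℕ → ℝ} (he : StrictMono e)
    (hpos : ∀ i ≤ N, 0 < x i) (hx : ∀ i j, i < j → j ≤ N → x i < x j)
    (hval : ∀ i ≤ N, muntzSum (N + 1) a e (x i) = if i = j then 1 else 0) :
    (∀ i ≤ N, 0 < (-1) ^ (i + j) * a i) ∧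
      ∀ y, 0 < y → y < x 0 → 0 < (-1) ^ j * muntzSum (N + 1) a e y := by
  have hne : ∃ i ≤ N, a i ≠ 0 := by
    by_contra hcon
    push Not at hcon
    have h := hval j hj
    rw [if_pos rfl, muntzSum, Finset.sum_eq_zero] at h
    · exact zero_ne_one h
    · intro i hi
      rw [hcon i (by have := Finset.mem_range.1 hi; omega), zero_mul]
  -- The nodes other than `x j` are already the maximal number of zeros. The value `1` at `x j` then
  -- fixes the sign of `a 0`.
  obtain ⟨h1, h2⟩ := muntzSum_sign_of_ne_zero (n := N) (a := a) (z := fun i => x (skipAt j i)) he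
    (fun i hi => hpos _ (skipAt_le hi))
    (fun i i' hii hi' => hx _ _ (strictMono_skipAt j hii) (skipAt_le hi'))
    (fun i hi => by rw [hval _ (skipAt_le hi), if_neg (skipAt_ne j i)]) hne
  have h3 := h2 (x j) (hpos j hj) j hj
    (fun i hi => hx _ _ (by simp [skipAt, hi]) hj)
    (fun i hji hi => hx _ _ (by simp only [skipAt]; split_ifs <;> omega) (skipAt_le hi))
  rw [hval j hj, if_pos rfl, mul_one] at h3
  have ha0 : a 0 ≠ 0 := by
    rintro h; rw [h, mul_zero] at h3; exact lt_irrefl _ h3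
  have hsq : 0 < a 0 ^ 2 := by positivity
  refine ⟨fun i hi => ?_, fun y hy hyx => ?_⟩
  · have h4 := mul_pos (h1 i hi) h3
    have h5 : (-1 : ℝ) ^ i * a i * a 0 * ((-1) ^ j * a 0) = (-1) ^ (i + j) * a i * a 0 ^ 2 := by
      rw [pow_add]; ring
    rw [h5] at h4
    exact pos_of_mul_pos_left h4 hsq.le
  · have h4 := mul_pos (h2 y hy 0 (Nat.zero_le _) (fun i hi => absurd hi (Nat.not_lt_zero i))
      (fun i _ hi => hyx.trans_le (by
        rcases Nat.eq_zero_or_pos (skipAt j i) with h | h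
        · rw [h]
        · exact (hx _ _ h (skipAt_le hi)).le))) h3
    have h5 : (-1 : ℝ) ^ 0 * muntzSum (N + 1) a e y * a 0 * ((-1) ^ j * a 0)
        = (-1) ^ j * muntzSum (N + 1) a e y * a 0 ^ 2 := by
      ring
    rw [h5] at h4
    exact pos_of_mul_pos_left h4 hsq.le

/-- Lowering one exponent increases the fundamental functions to the left of the nodes. -/
lemma lagrange_compare_skipAt {N j k : ℕ} (hj : j ≤ N) (hk : k ≤ N) {a b f x : ℕ → ℝ}
    (hf : StrictMono f) (hpos : ∀ i ≤ N, 0 < x i) (hx : ∀ i j, i < j → j ≤ N → x i < x j)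
    (ha : ∀ i ≤ N, muntzSum (N + 1) a (f ∘ skipAt k) (x i) = if i = j then 1 else 0)
    (hb : ∀ i ≤ N, muntzSum (N + 1) b (f ∘ skipAt (k + 1)) (x i) = if i = j then 1 else 0)
    {y : ℝ} (hy : 0 < y) (hyx : y < x 0) :
    |muntzSum (N + 1) a (f ∘ skipAt k) y| ≤ |muntzSum (N + 1) b (f ∘ skipAt (k + 1)) y| := by
  -- Over the common exponents `f 0, …, f (N + 1)` the difference has `N + 2` terms and vanishes at
  -- all `N + 1` nodes. One known coefficient sign therefore determines its sign to the left of the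
  -- nodes; the coefficient `d k` comes from `b` alone.
  set d : ℕ → ℝ := fun i => insertZero k a i - insertZero (k + 1) b i with hd
  have hD : ∀ t, muntzSum (N + 2) d f t =
      muntzSum (N + 1) a (f ∘ skipAt k) t - muntzSum (N + 1) b (f ∘ skipAt (k + 1)) t := by
    intro t
    rw [hd, muntzSum_sub, muntzSum_insertZero (by omega), muntzSum_insertZero (by omega)]
  have ha' := lagrange_sign hj (hf.comp (strictMono_skipAt k)) hpos hx ha
  have hb' := lagrange_sign hj (hf.comp (strictMono_skipAt (k + 1))) hpos hx hb
  have hdk : d k = -b k := by simp [hd, insertZero]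
  have hbk := hb'.1 k hk
  have hdk0 : d k ≠ 0 := by
    rw [hdk]
    rintro h
    rw [neg_eq_zero.1 h, mul_zero] at hbk
    exact lt_irrefl _ hbk
  obtain ⟨h1, h2⟩ := muntzSum_sign_of_ne_zero (n := N + 1) (a := d) (z := x) hf
    (fun i hi => hpos i (by omega)) (fun i j hij hj => hx i j hij (by omega))
    (fun i hi => by rw [hD, ha i (by omega), hb i (by omega), sub_self]) ⟨k, by omega, hdk0⟩
  have h3 := h1 k (by omega)
  have h4 := h2 y hy 0 (Nat.zero_le _) (fun i hi => absurd hi (Nat.not_lt_zero i))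
    (fun i _ hi => hyx.trans_le (by
        rcases Nat.eq_zero_or_pos i with h | h
        · rw [h]
        · exact (hx _ _ h (by omega)).le))
  rw [hD, pow_zero, one_mul] at h4
  have hP := ha'.2 y hy hyx
  have hQ := hb'.2 y hy hyx
  rw [hdk] at h3
  have hpk : ((-1 : ℝ) ^ k) ^ 2 = 1 := by rw [← pow_mul, mul_comm, pow_mul]; norm_num
  have hpj : |(-1 : ℝ) ^ j| = 1 := by rw [abs_pow, abs_neg, abs_one, one_pow]
  have hd0 : (-1) ^ j * d 0 < 0 := by
    have h5 : 0 < ((-1 : ℝ) ^ k * -b k * d 0) * ((-1) ^ (k + j) * b k) := mul_pos h3 hbk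
    have h6 : ((-1 : ℝ) ^ k * -b k * d 0) * ((-1) ^ (k + j) * b k)
        = -((-1) ^ j * d 0) * (((-1 : ℝ) ^ k) ^ 2 * b k ^ 2) := by rw [pow_add]; ring
    rw [h6, hpk, one_mul] at h5
    have h7 := pos_of_mul_pos_left h5 (sq_nonneg _)
    linarith
  have hlt : (-1) ^ j * muntzSum (N + 1) a (f ∘ skipAt k) y
      < (-1) ^ j * muntzSum (N + 1) b (f ∘ skipAt (k + 1)) y := by
    set P := muntzSum (N + 1) a (f ∘ skipAt k) y
    set Q := muntzSum (N + 1) b (f ∘ skipAt (k + 1)) y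
    have hpj2 : ((-1 : ℝ) ^ j) ^ 2 = 1 := by rw [← pow_mul, mul_comm, pow_mul]; norm_num
    have h8 : (P - Q) * d 0 = ((-1) ^ j * (P - Q)) * ((-1) ^ j * d 0) := by
      calc (P - Q) * d 0 = ((-1 : ℝ) ^ j) ^ 2 * ((P - Q) * d 0) := by rw [hpj2, one_mul]
        _ = _ := by ring
    rw [h8] at h4
    have h9 : (-1) ^ j * (P - Q) < 0 := by
      by_contra hcon
      exact absurd h4 (not_lt.2 (mul_nonpos_of_nonneg_of_nonpos (not_lt.1 hcon) hd0.le))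
    linarith
  calc |muntzSum (N + 1) a (f ∘ skipAt k) y|
      = |(-1) ^ j * muntzSum (N + 1) a (f ∘ skipAt k) y| := by rw [abs_mul, hpj, one_mul]
    _ ≤ |(-1) ^ j * muntzSum (N + 1) b (f ∘ skipAt (k + 1)) y| := by
        rw [abs_of_pos hP, abs_of_pos hQ]; exact hlt.le
    _ = _ := by rw [abs_mul, hpj, one_mul]

/-! ### Interpolation weights and their monotonicity in the exponents -/

lemma muntzSum_eq_sum_fin (n : ℕ) (a e : ℕ → ℝ) (x : ℝ) :
    muntzSum n a e x = ∑ i : Fin n, a i * x ^ e i :=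
  Finset.sum_range (fun i => a i * x ^ e i)

/-- A vector in the kernel is the coefficient vector of a sum with `N + 1` terms and `N + 1`
positive zeros. -/
lemma isUnit_muntz_matrix {N : ℕ} {e x : ℕ → ℝ} (he : StrictMono e)
    (hpos : ∀ i ≤ N, 0 < x i) (hx : ∀ i j, i < j → j ≤ N → x i < x j) :
    IsUnit (Matrix.of fun i j : Fin (N + 1) => x i ^ e j) := by
  rw [← Matrix.mulVec_injective_iff_isUnit]
  rw [← Matrix.coe_mulVecLin, injective_iff_map_eq_zero]
  intro a ha
  have h := muntzSum_coeff_eq_zero (N + 1) (fun i => if h : i < N + 1 then a ⟨i, h⟩ else 0) e x he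
    (fun i hi => hpos i (by omega)) (fun i j hij hj => hx i j hij (by omega))
    (fun i hi => by
      have h1 := congrFun ha ⟨i, hi⟩
      rw [muntzSum_eq_sum_fin]
      simp only [Matrix.mulVecLin_apply, Matrix.mulVec, dotProduct, Matrix.of_apply,
        Pi.zero_apply] at h1
      rw [← h1]
      refine Finset.sum_congr rfl fun j _ => ?_
      rw [dif_pos j.2, mul_comm])
  funext i
  have := h i i.2
  rw [dif_pos i.2] at this
  exact this

lemma exists_muntzSum_eq {N : ℕ} {e x : ℕ → ℝ} (he : StrictMono e)
    (hpos : ∀ i ≤ N, 0 < x i) (hx : ∀ i j, i < j → j ≤ N → x i < x j) (u : ℕ → ℝ) :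
    ∃ a : ℕ → ℝ, ∀ i ≤ N, muntzSum (N + 1) a e (x i) = u i := by
  obtain ⟨a, ha⟩ := Matrix.mulVec_surjective_iff_isUnit.2 (isUnit_muntz_matrix he hpos hx)
    (fun i : Fin (N + 1) => u i)
  refine ⟨fun i => if h : i < N + 1 then a ⟨i, h⟩ else 0, fun i hi => ?_⟩
  have h1 := congrFun ha ⟨i, by omega⟩
  simp only [Matrix.mulVec, dotProduct, Matrix.of_apply] at h1
  rw [muntzSum_eq_sum_fin, ← h1]
  refine Finset.sum_congr rfl fun j _ => ?_
  rw [dif_pos j.2, mul_comm]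

/-- `w` are the weights at the nodes `x 0, …, x N` of the formula which recovers the value at `y`
of all generalized polynomials with exponents `e 0, …, e N`. -/
def IsWeights (N : ℕ) (e x : ℕ → ℝ) (y : ℝ) (w : ℕ → ℝ) : Prop :=
  ∀ i ≤ N, ∑ j ∈ Finset.range (N + 1), w j * x j ^ e i = y ^ e i

lemma exists_isWeights {N : ℕ} {e x : ℕ → ℝ} (he : StrictMono e)
    (hpos : ∀ i ≤ N, 0 < x i) (hx : ∀ i j, i < j → j ≤ N → x i < x j) (y : ℝ) :
    ∃ w : ℕ → ℝ, IsWeights N e x y w := by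
  obtain ⟨a, ha⟩ := Matrix.vecMul_surjective_iff_isUnit.2 (isUnit_muntz_matrix he hpos hx)
    (fun i : Fin (N + 1) => y ^ e i)
  refine ⟨fun i => if h : i < N + 1 then a ⟨i, h⟩ else 0, fun i hi => ?_⟩
  have h1 := congrFun ha ⟨i, by omega⟩
  simp only [Matrix.vecMul, dotProduct, Matrix.of_apply] at h1
  rw [Finset.sum_range, ← h1]
  refine Finset.sum_congr rfl fun j _ => ?_
  simp only [dif_pos j.2]

lemma IsWeights.muntzSum_eq {N : ℕ} {e x w : ℕ → ℝ} {y : ℝ} (hw : IsWeights N e x y w)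
    (a : ℕ → ℝ) :
    muntzSum (N + 1) a e y = ∑ j ∈ Finset.range (N + 1), w j * muntzSum (N + 1) a e (x j) := by
  simp only [muntzSum, Finset.mul_sum]
  rw [Finset.sum_comm]
  refine Finset.sum_congr rfl fun i hi => ?_
  rw [← hw i (by have := Finset.mem_range.1 hi; omega), Finset.mul_sum]
  exact Finset.sum_congr rfl fun j _ => by ring

/-- This translates the comparison of fundamental functions into a comparison of weights. -/
lemma IsWeights.eq_lagrange {N j : ℕ} (hj : j ≤ N) {e x w a : ℕ → ℝ} {y : ℝ}
    (hw : IsWeights N e x y w)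
    (ha : ∀ i ≤ N, muntzSum (N + 1) a e (x i) = if i = j then 1 else 0) :
    w j = muntzSum (N + 1) a e y := by
  rw [hw.muntzSum_eq a, Finset.sum_eq_single j]
  · rw [ha j hj, if_pos rfl, mul_one]
  · intro i hi hij
    rw [ha i (by have := Finset.mem_range.1 hi; omega), if_neg hij, mul_zero]
  · intro h
    exact absurd (Finset.mem_range.2 (by omega)) h

/-- Replacing the exponents by smaller ones increases the weights in absolute value. -/
lemma IsWeights.abs_le_of_exp_le {N : ℕ} {e e' x w v : ℕ → ℝ} {y : ℝ} (he : StrictMono e)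
    (he' : StrictMono e') (hle : ∀ i, e' i ≤ e i)
    (hx : ∀ i j, i < j → j ≤ N → x i < x j) (hy : 0 < y) (hyx : y < x 0)
    (hw : IsWeights N e x y w) (hv : IsWeights N e' x y v) {j : ℕ} (hj : j ≤ N) :
    |w j| ≤ |v j| := by
  have hpos : ∀ i ≤ N, 0 < x i := by
    intro i hi
    rcases Nat.eq_zero_or_pos i with h | h
    · rw [h]; exact hy.trans hyx
    · exact hy.trans (hyx.trans (hx 0 i h hi))
  -- The exponents are replaced one at a time starting from the lowest; in this order every
  -- intermediate sequence stays strictly increasing.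
  set mix : ℕ → ℕ → ℝ := fun k i => if i < k then e' i else e i with hmix
  have hmixmono : ∀ k, StrictMono (mix k) := by
    intro k i i' hii
    simp only [hmix]
    split_ifs with h1 h2
    · exact he' hii
    · exact (hle i).trans_lt (he hii)
    · omega
    · exact he hii
  have key : ∀ k ≤ N + 1, ∀ u, IsWeights N (mix k) x y u → |w j| ≤ |u j| := by
    intro k
    induction k with
    | zero =>
      intro _ u hu
      obtain ⟨a, ha⟩ := exists_muntzSum_eq he hpos hx (fun i => if i = j then 1 else 0)
      have h0 : mix 0 = e := by funext i; simp [hmix]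
      rw [h0] at hu
      rw [hw.eq_lagrange hj ha, hu.eq_lagrange hj ha]
    | succ k ih =>
      intro hk u hu
      obtain ⟨u', hu'⟩ := exists_isWeights (hmixmono k) hpos hx y
      refine (ih (by omega) u' hu').trans ?_
      obtain ⟨a, ha⟩ := exists_muntzSum_eq (hmixmono k) hpos hx (fun i => if i = j then 1 else 0)
      obtain ⟨b, hb⟩ := exists_muntzSum_eq (hmixmono (k + 1)) hpos hx
        (fun i => if i = j then 1 else 0)
      rw [hu'.eq_lagrange hj ha, hu.eq_lagrange hj hb]
      rcases (hle k).eq_or_lt with h | h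
      · have h0 : mix (k + 1) = mix k := by
          funext i
          simp only [hmix]
          rcases lt_trichotomy i k with h1 | h1 | h1
          · rw [if_pos (by omega), if_pos h1]
          · subst h1; rw [if_pos (by omega), if_neg (by omega), h]
          · rw [if_neg (by omega), if_neg (by omega)]
        rw [← hu'.eq_lagrange hj ha, ← hu.eq_lagrange hj hb]
        rw [h0] at hu
        rw [hu'.eq_lagrange hj ha, hu.eq_lagrange hj ha]
      -- Here both `f k = e' k` and `f (k + 1) = e k` are kept: omitting the first gives `mix k`,
      -- omitting the second gives `mix (k + 1)`.
      · set f : ℕ → ℝ := fun i => if i ≤ k then e' i else e (i - 1) with hfdef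
        have hf : StrictMono f := by
          refine strictMono_nat_of_lt_succ fun i => ?_
          simp only [hfdef]
          rcases lt_trichotomy i k with h1 | h1 | h1
          · rw [if_pos h1.le, if_pos (by omega)]; exact he' (Nat.lt_succ_self i)
          · subst h1; rw [if_pos le_rfl, if_neg (by omega)]; exact h
          · rw [if_neg (by omega), if_neg (by omega)]; exact he (by omega)
        have h1 : mix k = f ∘ skipAt k := by
          funext i
          simp only [hmix, hfdef, skipAt, Function.comp]
          split_ifs <;> first | rfl | omega
        have h2 : mix (k + 1) = f ∘ skipAt (k + 1) := by
          funext i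
          simp only [hmix, hfdef, skipAt, Function.comp]
          split_ifs <;> first | rfl | omega
        rw [h1] at ha ⊢
        rw [h2] at hb ⊢
        exact lagrange_compare_skipAt hj (by omega) hf hpos hx ha hb hy hyx
  refine key (N + 1) le_rfl v fun i hi => ?_
  have : mix (N + 1) i = e' i := by simp only [hmix]; rw [if_pos (by omega)]
  rw [this]
  exact hv i hi

/-! ### Remez inequality for a fixed number of terms -/

/-- A set of outer measure greater than `2 h N` has `N + 1` points with gaps at least `h`. -/
lemma exists_separated_points {h : ℝ} (hh : 0 < h) (N : ℕ) : ∀ E : Set ℝ, BddBelow E →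
    ENNReal.ofReal (2 * h * N) < volume E →
    ∃ x : ℕ → ℝ, (∀ i ≤ N, x i ∈ E) ∧ ∀ i < N, x i + h ≤ x (i + 1) := by
  induction N with
  | zero =>
    intro E _ hE
    have hne : E.Nonempty := by
      rw [Set.nonempty_iff_ne_empty]
      rintro rfl
      simp at hE
    exact ⟨fun _ => hne.some, fun _ _ => hne.some_mem, fun i hi => absurd hi (Nat.not_lt_zero i)⟩
  | succ N ih =>
    intro E hbdd hE
    have hne : E.Nonempty := by
      rw [Set.nonempty_iff_ne_empty]
      rintro rfl
      simp at hE
    -- A point within `h` of the infimum: discarding everything below `t + h` loses measure at most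
    -- `2 * h`.
    obtain ⟨t, htE, ht⟩ := exists_lt_of_csInf_lt hne (lt_add_of_pos_right (sInf E) hh)
    have hsub : E ⊆ Set.Icc (sInf E) (sInf E + 2 * h) ∪ (E ∩ Set.Ici (t + h)) := by
      intro u hu
      rcases le_or_gt (t + h) u with h1 | h1
      · exact Or.inr ⟨hu, h1⟩
      · exact Or.inl ⟨csInf_le hbdd hu, by linarith⟩
    have hvol : ENNReal.ofReal (2 * h * N) < volume (E ∩ Set.Ici (t + h)) := by
      by_contra hcon
      have h1 : volume E ≤ ENNReal.ofReal (2 * h) + ENNReal.ofReal (2 * h * N) := by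
        refine (measure_mono hsub).trans ((measure_union_le _ _).trans ?_)
        rw [Real.volume_Icc]
        have : sInf E + 2 * h - sInf E = 2 * h := by ring
        rw [this]
        exact add_le_add le_rfl (not_lt.1 hcon)
      rw [← ENNReal.ofReal_add (by positivity) (by positivity)] at h1
      have h2 : 2 * h + 2 * h * N = 2 * h * ((N + 1 : ℕ) : ℝ) := by push_cast; ring
      rw [h2] at h1
      exact absurd hE (not_lt.2 h1)
    obtain ⟨x, hx1, hx2⟩ := ih _ (hbdd.mono Set.inter_subset_left) hvol
    refine ⟨fun i => if i = 0 then t else x (i - 1), fun i hi => ?_, fun i hi => ?_⟩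
    · dsimp only
      rcases Nat.eq_zero_or_pos i with h0 | h0
      · simpa [h0] using htE
      · rw [if_neg h0.ne']
        exact (hx1 (i - 1) (by omega)).1
    · dsimp only
      rw [if_neg (Nat.succ_ne_zero i)]
      rcases Nat.eq_zero_or_pos i with h0 | h0
      · simpa [h0] using (hx1 0 (Nat.zero_le _)).2
      · rw [if_neg h0.ne']
        have := hx2 (i - 1) (by omega)
        rwa [Nat.sub_add_cancel h0] at this

lemma prod_erase_abs_sub {N j : ℕ} (hj : j ≤ N) :
    ∏ i ∈ (Finset.range (N + 1)).erase j, |(i : ℝ) - j| = (j.factorial : ℝ) * (N - j).factorial := by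
  induction N, hj using Nat.le_induction with
  | base =>
    have : (Finset.range (j + 1)).erase j = Finset.range j := by
      rw [Finset.range_add_one, Finset.erase_insert Finset.notMem_range_self]
    rw [this, ← Finset.prod_range_reflect, ← Finset.prod_range_add_one_eq_factorial]
    simp only [Nat.sub_self, Nat.factorial_zero, Nat.cast_one, mul_one, Nat.cast_prod]
    refine Finset.prod_congr rfl fun i hi => ?_
    have hi' := Finset.mem_range.1 hi
    have h1 : ((j - 1 - i : ℕ) : ℝ) = j - 1 - i := by
      rw [Nat.cast_sub (by omega), Nat.cast_sub (by omega)]; simp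
    rw [h1, abs_sub_comm, abs_of_nonneg] <;> push_cast <;> linarith
  | succ N hN ih =>
    have : (Finset.range (N + 1 + 1)).erase j = insert (N + 1) ((Finset.range (N + 1)).erase j) := by
      rw [Finset.range_add_one, Finset.erase_insert_of_ne (by omega)]
    rw [this, Finset.prod_insert (by simp), ih, Nat.succ_sub hN, Nat.factorial_succ]
    have h1 : |((N + 1 : ℕ) : ℝ) - j| = ((N - j + 1 : ℕ) : ℝ) := by
      have hN' : (j : ℝ) ≤ N := by exact_mod_cast hN
      rw [abs_of_nonneg]
      · push_cast [Nat.cast_sub hN]; ring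
      · push_cast; linarith
    rw [h1]; push_cast; ring

lemma prod_erase_div_abs_sub {N j : ℕ} (hj : j ≤ N) (C : ℝ) :
    ∏ i ∈ (Finset.range (N + 1)).erase j, C / |(i : ℝ) - j| =
      C ^ N * N.choose j / N.factorial := by
  rw [Finset.prod_div_distrib, prod_erase_abs_sub hj, Finset.prod_const,
    Finset.card_erase_of_mem (Finset.mem_range.2 (by omega)), Finset.card_range,
    Nat.add_sub_cancel, Nat.cast_choose ℝ hj]
  have : (N.factorial : ℝ) ≠ 0 := by positivity
  field_simp

/-- The summands are binomial coefficients up to the common factor `C ^ N / N!`. This bounds the sum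
of the Lagrange weights for separated nodes. -/
lemma sum_prod_erase_div_abs_sub (N : ℕ) (C : ℝ) :
    ∑ j ∈ Finset.range (N + 1), ∏ i ∈ (Finset.range (N + 1)).erase j, C / |(i : ℝ) - j| =
      (2 * C) ^ N / N.factorial := by
  have h : ∀ j ∈ Finset.range (N + 1),
      ∏ i ∈ (Finset.range (N + 1)).erase j, C / |(i : ℝ) - j| =
        C ^ N / N.factorial * N.choose j := by
    intro j hj
    rw [prod_erase_div_abs_sub (by have := Finset.mem_range.1 hj; omega)]; ring
  rw [Finset.sum_congr rfl h, ← Finset.mul_sum, ← Nat.cast_sum, Nat.sum_range_choose, mul_pow]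
  push_cast; ring

/-- Bernoulli's inequality for the exponent `c ≤ 1`, applied to `u / w`. The substitution `x ↦ x ^
c` shrinks gaps at most by the factor `c`; the next lemma bounds them above with the same factor,
which cancels in the weights. -/
lemma mul_sub_le_rpow_sub {c u w : ℝ} (hc : 0 < c) (hc1 : c ≤ 1) (hu : 0 < u) (huw : u ≤ w)
    (hw : w ≤ 1) : c * (w - u) ≤ w ^ c - u ^ c := by
  have hw0 : 0 < w := hu.trans_le huw
  have h1 := rpow_one_add_le_one_add_mul_self (s := u / w - 1)
    (by have := div_pos hu hw0; linarith) hc.le hc1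
  rw [add_sub_cancel, Real.div_rpow hu.le hw0.le, div_le_iff₀ (Real.rpow_pos_of_pos hw0 _)] at h1
  have h2 : w ≤ w ^ c := by
    simpa using Real.rpow_le_rpow_of_exponent_ge hw0 hw hc1
  have h3 : 0 ≤ 1 - u / w := by
    rw [sub_nonneg, div_le_one hw0]; exact huw
  have h4 : c * (1 - u / w) * w ≤ c * (1 - u / w) * w ^ c :=
    mul_le_mul_of_nonneg_left h2 (mul_nonneg hc.le h3)
  have h5 : c * (1 - u / w) * w = c * (w - u) := by field_simp
  nlinarith

lemma rpow_sub_le_mul_div {c u w : ℝ} (hc : 0 < c) (hc1 : c ≤ 1) (hu : 0 < u) (huw : u ≤ w)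
    (hu1 : u ≤ 1) : w ^ c - u ^ c ≤ c * ((w - u) / u) := by
  have h1 := rpow_one_add_le_one_add_mul_self (s := w / u - 1)
    (by have := div_pos (hu.trans_le huw) hu; linarith) hc.le hc1
  rw [add_sub_cancel, Real.div_rpow (hu.trans_le huw).le hu.le,
    div_le_iff₀ (Real.rpow_pos_of_pos hu _)] at h1
  have h2 : u ^ c ≤ 1 := Real.rpow_le_one hu.le hu1 hc.le
  have h3 : (w - u) / u = w / u - 1 := by field_simp
  have h4 : 0 ≤ w / u - 1 := by rw [← h3]; exact div_nonneg (by linarith) hu.le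
  rw [h3]
  nlinarith [mul_nonneg (mul_nonneg hc.le h4) (sub_nonneg.2 h2)]

/-- The weights for the exponents `c * i` are those of Lagrange interpolation. -/
lemma isWeights_lagrange {N : ℕ} {c : ℝ} {x : ℕ → ℝ} {y : ℝ} (hpos : ∀ i ≤ N, 0 < x i) (hy : 0 < y)
    (hinj : Set.InjOn (fun i => x i ^ c) (Finset.range (N + 1) : Set ℕ)) :
    IsWeights N (fun i => c * i) x y fun j =>
      ∏ i ∈ (Finset.range (N + 1)).erase j, (y ^ c - x i ^ c) / (x j ^ c - x i ^ c) := by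
  intro i hi
  have h := Lagrange.eq_interpolate (s := Finset.range (N + 1)) (f := (Polynomial.X : Polynomial ℝ) ^ i) hinj
    (by
      rw [Polynomial.degree_X_pow, Finset.card_range]
      exact_mod_cast Nat.lt_succ_of_le hi)
  have h2 := congrArg (Polynomial.eval (y ^ c)) h
  rw [Lagrange.interpolate_apply, Polynomial.eval_finsetSum] at h2
  simp only [Polynomial.eval_pow, Polynomial.eval_X, Polynomial.eval_mul, Polynomial.eval_C,
    Lagrange.basis, Polynomial.eval_prod, Lagrange.basisDivisor, Polynomial.eval_sub] at h2
  rw [Real.rpow_mul hy.le, Real.rpow_natCast, h2]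
  refine Finset.sum_congr rfl fun j hj => ?_
  rw [Real.rpow_mul (hpos j (by have := Finset.mem_range.1 hj; omega)).le, Real.rpow_natCast, mul_comm]
  congr 1
  refine Finset.prod_congr rfl fun k _ => ?_
  rw [div_eq_inv_mul]

lemma add_mul_le_of_separated {N : ℕ} {h : ℝ} {x : ℕ → ℝ} (hx : ∀ i < N, x i + h ≤ x (i + 1))
    {i j : ℕ} (hij : i ≤ j) (hj : j ≤ N) : x i + ((j : ℝ) - i) * h ≤ x j := by
  induction j, hij using Nat.le_induction with
  | base => simp
  | succ j hij ih =>
    have := ih (by omega)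
    have h2 := hx j (by omega)
    push_cast
    linarith

/-- A Remez-type inequality at separated points. -/
lemma abs_muntzSum_le_of_separated {N : ℕ} {a e x : ℕ → ℝ} {c h B y b : ℝ} (he : StrictMono e)
    (hc : 0 < c) (hc1 : c ≤ 1) (hce : ∀ i : ℕ, c * i ≤ e i) (hh : 0 < h) (hy : 0 < y)
    (hyx : y < x 0) (hx : ∀ i < N, x i + h ≤ x (i + 1)) (hx1 : ∀ i ≤ N, x i ≤ 1)
    (hB : ∀ i ≤ N, x i ^ c - y ^ c ≤ c * B) (hb : ∀ i ≤ N, |muntzSum (N + 1) a e (x i)| ≤ b) :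
    |muntzSum (N + 1) a e y| ≤ (2 * (B / h)) ^ N / N.factorial * b := by
  have hxs : ∀ i j, i < j → j ≤ N → x i < x j := by
    intro i j hij hj
    have h1 := add_mul_le_of_separated hx hij.le hj
    have h2 : (0 : ℝ) < (j : ℝ) - i := sub_pos.2 (by exact_mod_cast hij)
    nlinarith [mul_pos h2 hh]
  have hyx' : ∀ i ≤ N, y < x i := by
    intro i hi
    rcases Nat.eq_zero_or_pos i with h0 | h0
    · rw [h0]; exact hyx
    · exact hyx.trans (hxs 0 i h0 hi)
  have hpos : ∀ i ≤ N, 0 < x i := fun i hi => hy.trans (hyx' i hi)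
  have hgap' : ∀ i j, i < j → j ≤ N → c * h * |(i : ℝ) - j| ≤ x j ^ c - x i ^ c := by
    intro i j hij hj
    refine le_trans ?_ (mul_sub_le_rpow_sub hc hc1 (hpos i (by omega)) (hxs i j hij hj).le (hx1 j hj))
    rw [abs_sub_comm, abs_of_pos (sub_pos.2 (by exact_mod_cast hij)), mul_assoc]
    refine mul_le_mul_of_nonneg_left ?_ hc.le
    have h1 := add_mul_le_of_separated hx hij.le hj
    linarith
  have hgap : ∀ i j, i ≠ j → i ≤ N → j ≤ N → c * h * |(i : ℝ) - j| ≤ |x j ^ c - x i ^ c| := by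
    intro i j hij hi hj
    rcases lt_or_gt_of_ne hij with h1 | h1
    · exact (hgap' i j h1 hj).trans (le_abs_self _)
    · rw [abs_sub_comm, abs_sub_comm (x j ^ c)]
      exact (hgap' j i h1 hi).trans (le_abs_self _)
  have hdist : ∀ i j : ℕ, i ≠ j → 0 < |(i : ℝ) - j| := fun i j hij =>
    abs_pos.2 (sub_ne_zero.2 (by exact_mod_cast hij))
  have hinj : Set.InjOn (fun i => x i ^ c) (Finset.range (N + 1) : Set ℕ) := by
    intro i hi j hj hij
    by_contra hne
    have hi' : i < N + 1 := by simpa using hi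
    have hj' : j < N + 1 := by simpa using hj
    have h1 := hgap i j hne (by omega) (by omega)
    have h2 : x i ^ c = x j ^ c := hij
    rw [h2, sub_self, abs_zero] at h1
    have := mul_pos (mul_pos hc hh) (hdist i j hne)
    linarith
  obtain ⟨w, hw⟩ := exists_isWeights he hpos hxs y
  have hv := isWeights_lagrange hpos hy hinj
  have hcmono : StrictMono fun i : ℕ => c * (i : ℝ) := by
    intro i j hij
    have : (i : ℝ) < j := by exact_mod_cast hij
    exact mul_lt_mul_of_pos_left this hc
  have hwle : ∀ j ∈ Finset.range (N + 1),
      |w j| ≤ ∏ i ∈ (Finset.range (N + 1)).erase j, (B / h) / |(i : ℝ) - j| := by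
    intro j hj
    have hj' : j ≤ N := by have := Finset.mem_range.1 hj; omega
    refine (hw.abs_le_of_exp_le he hcmono hce hxs hy hyx hv hj').trans ?_
    rw [Finset.abs_prod]
    refine Finset.prod_le_prod (fun _ _ => abs_nonneg _) fun i hi => ?_
    have hij := Finset.ne_of_mem_erase hi
    have hi' : i ≤ N := by have := Finset.mem_range.1 (Finset.mem_of_mem_erase hi); omega
    have h1 : |y ^ c - x i ^ c| ≤ c * B := by
      rw [abs_sub_comm, abs_of_nonneg]
      · exact hB i hi'
      · exact sub_nonneg.2 (Real.rpow_le_rpow hy.le (hyx' i hi').le hc.le)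
    have h2 := hdist i j hij
    rw [abs_div]
    calc |y ^ c - x i ^ c| / |x j ^ c - x i ^ c| ≤ (c * B) / (c * h * |(i : ℝ) - j|) :=
          div_le_div₀ ((abs_nonneg _).trans h1) h1 (by positivity) (hgap i j hij hi' hj')
      _ = _ := by field_simp
  have hb0 : 0 ≤ b := (abs_nonneg _).trans (hb 0 (Nat.zero_le _))
  rw [hw.muntzSum_eq a, ← sum_prod_erase_div_abs_sub, Finset.sum_mul]
  refine (Finset.abs_sum_le_sum_abs _ _).trans (Finset.sum_le_sum fun j hj => ?_)
  rw [abs_mul]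
  exact mul_le_mul (hwle j hj) (hb j (by have := Finset.mem_range.1 hj; omega)) (abs_nonneg _)
    ((abs_nonneg _).trans (hwle j hj))

/-- A Remez-type inequality for a fixed number of terms. -/
lemma abs_muntzSum_le_of_measure {N : ℕ} {a e : ℕ → ℝ} {c δ B y b : ℝ} (he : StrictMono e)
    (hc : 0 < c) (hc1 : c ≤ 1) (hce : ∀ i : ℕ, c * i ≤ e i) (hy : 0 < y) (hδ : 0 < δ) {E : Set ℝ}
    (hE : E ⊆ Set.Ioc y 1) (hvol : ENNReal.ofReal δ ≤ volume E)
    (hB : ∀ x ∈ E, x ^ c - y ^ c ≤ c * B) (hb : ∀ x ∈ E, |muntzSum (N + 1) a e x| ≤ b) :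
    |muntzSum (N + 1) a e y| ≤ (4 * (N + 1) * B / δ) ^ N / N.factorial * b := by
  have hN : (0 : ℝ) < N + 1 := by positivity
  have hh : 0 < δ / (2 * (N + 1)) := by positivity
  -- With gaps `h = δ / (2 * (N + 1))` the required measure `2 * h * N` is strictly below `δ`.
  obtain ⟨x, hx1, hx2⟩ := exists_separated_points hh N E ⟨y, fun x hx => (hE hx).1.le⟩ (by
    refine lt_of_lt_of_le ?_ hvol
    rw [ENNReal.ofReal_lt_ofReal_iff hδ]
    have : 2 * (δ / (2 * ((N : ℝ) + 1))) * N = δ * (N / (N + 1)) := by field_simp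
    rw [this]
    have h2 : (N : ℝ) / (N + 1) < 1 := by rw [div_lt_one hN]; linarith
    nlinarith)
  have h := abs_muntzSum_le_of_separated (a := a) he hc hc1 hce hh hy (hE (hx1 0 (Nat.zero_le _))).1
    hx2 (fun i hi => (hE (hx1 i hi)).2) (fun i hi => hB _ (hx1 i hi)) (fun i hi => hb _ (hx1 i hi))
  have h2 : 2 * (B / (δ / (2 * ((N : ℝ) + 1)))) = 4 * (N + 1) * B / δ := by field_simp; ring
  rwa [h2] at h

/-! ### Coefficient bounds and smallness of the upper half of the terms -/

/-- A coefficient is bounded by the values at the points of a geometric progression. -/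
lemma abs_coeff_mul_rpow_le {n j : ℕ} {a g : ℕ → ℝ} {y ρ M : ℝ} (hj : j < n) (hy : 0 < y)
    (hρ : 0 < ρ) (hρ1 : ρ ≤ 1) (hg : ∀ i, 0 ≤ g i)
    (hM : ∀ l < n, |muntzSum n a g (y * ρ ^ l)| ≤ M)
    (hne : ∀ i < n, i ≠ j → ρ ^ g j ≠ ρ ^ g i) :
    |a j| * y ^ g j ≤ M * ∏ i ∈ (Finset.range n).erase j, 2 / |ρ ^ g j - ρ ^ g i| := by
  -- For each `k`, the operator `f ↦ (f (ρ x) - ρ ^ g k * f x) / (ρ ^ g j - ρ ^ g k)` kills the term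
  -- `k`, fixes the term `j`, and costs a factor `2 / |ρ ^ g j - ρ ^ g k|`. Applying it for all `i ∈
  -- s` uses `s.card` further points of the progression.
  have key : ∀ s : Finset ℕ, s ⊆ (Finset.range n).erase j → ∀ l, l + s.card < n →
      |muntzSum n (fun m => a m * ∏ i ∈ s, (ρ ^ g m - ρ ^ g i) / (ρ ^ g j - ρ ^ g i)) g
        (y * ρ ^ l)| ≤ M * ∏ i ∈ s, 2 / |ρ ^ g j - ρ ^ g i| := by
    intro s
    induction s using Finset.induction_on with
    | empty =>
      intro _ l hl
      simpa using hM l (by simpa using hl)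
    | insert k s hk ih =>
      intro hs l hl
      have hs' : s ⊆ (Finset.range n).erase j := (Finset.subset_insert k s).trans hs
      rw [Finset.card_insert_of_notMem hk] at hl
      have h0 := ih hs' l (by omega)
      have h1 := ih hs' (l + 1) (by omega)
      have hkm := hs (Finset.mem_insert_self k s)
      have hd : 0 < |ρ ^ g j - ρ ^ g k| := abs_pos.2 (sub_ne_zero.2
        (hne k (Finset.mem_range.1 (Finset.mem_of_mem_erase hkm)) (Finset.ne_of_mem_erase hkm)))
      set b : ℕ → ℝ := fun m => a m * ∏ i ∈ s, (ρ ^ g m - ρ ^ g i) / (ρ ^ g j - ρ ^ g i) with hb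
      have heq : muntzSum n (fun m => a m * ∏ i ∈ insert k s,
          (ρ ^ g m - ρ ^ g i) / (ρ ^ g j - ρ ^ g i)) g (y * ρ ^ l)
          = (muntzSum n b g (y * ρ ^ (l + 1)) - ρ ^ g k * muntzSum n b g (y * ρ ^ l))
            / (ρ ^ g j - ρ ^ g k) := by
        simp only [muntzSum, Finset.mul_sum, ← Finset.sum_sub_distrib, Finset.sum_div]
        refine Finset.sum_congr rfl fun m _ => ?_
        rw [Finset.prod_insert hk, pow_succ, ← mul_assoc y,
          Real.mul_rpow (by positivity) hρ.le]
        simp only [hb]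
        ring
      have hz : 0 ≤ ρ ^ g k := (Real.rpow_pos_of_pos hρ _).le
      have hz1 : ρ ^ g k ≤ 1 := Real.rpow_le_one hρ.le hρ1 (hg k)
      rw [heq, abs_div, Finset.prod_insert hk, div_le_iff₀ hd]
      set T := M * ∏ i ∈ s, 2 / |ρ ^ g j - ρ ^ g i| with hT
      have h2 : M * (2 / |ρ ^ g j - ρ ^ g k| * ∏ i ∈ s, 2 / |ρ ^ g j - ρ ^ g i|)
          * |ρ ^ g j - ρ ^ g k| = 2 * T := by
        rw [hT]; field_simp
      rw [h2]
      refine (abs_sub _ _).trans ?_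
      rw [abs_mul, abs_of_nonneg hz]
      have h3 : ρ ^ g k * |muntzSum n b g (y * ρ ^ l)| ≤ 1 * T :=
        mul_le_mul hz1 h0 (abs_nonneg _) zero_le_one
      linarith
  have h := key _ (Finset.Subset.refl _) 0 (by
    rw [Finset.card_erase_of_mem (Finset.mem_range.2 hj), Finset.card_range]; omega)
  rw [pow_zero, mul_one] at h
  refine le_trans (le_of_eq ?_) h
  rw [muntzSum, Finset.sum_eq_single j]
  · rw [Finset.prod_eq_one, mul_one, abs_mul, abs_of_pos (Real.rpow_pos_of_pos hy _)]
    intro i hi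
    exact div_self (sub_ne_zero.2
      (hne i (Finset.mem_range.1 (Finset.mem_of_mem_erase hi)) (Finset.ne_of_mem_erase hi)))
  · intro i hi hij
    rw [Finset.prod_eq_zero (Finset.mem_erase.2 ⟨hij, hi⟩) (by rw [sub_self, zero_div]), mul_zero,
      zero_mul]
  · intro h
    exact absurd (Finset.mem_range.2 hj) h

lemma sub_div_le_one_sub_sqrt_div {i j : ℝ} (hi : 0 ≤ i) (hj : 0 < j) :
    (j - i) / (2 * j) ≤ 1 - √i / √j := by
  have hsj := Real.sqrt_pos.2 hj
  have h1 := Real.sq_sqrt hi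
  have h2 := Real.sq_sqrt hj.le
  have h3 : (j - i) / (2 * j) = (√j ^ 2 - √i ^ 2) / (2 * √j ^ 2) := by rw [h1, h2]
  have h4 : 1 - √i / √j = (√j - √i) / √j := by field_simp
  rw [h3, h4, div_le_div_iff₀ (by positivity) hsj]
  nlinarith [mul_nonneg hsj.le (sq_nonneg (√j - √i))]

lemma sub_div_le_sqrt_div_sub_one {i j : ℝ} (hj : 0 < j) (hij : j ≤ i) (hij2 : i ≤ 2 * j) :
    (i - j) / (3 * j) ≤ √i / √j - 1 := by
  have h : √i / √j = √(1 + (i - j) / j) := by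
    rw [← Real.sqrt_div (hj.le.trans hij)]; congr 1; field_simp; ring
  have h0 : 0 ≤ (i - j) / j := div_nonneg (by linarith) hj.le
  have h1 : (i - j) / j ≤ 1 := by rw [div_le_one hj]; linarith
  have h2 : (i - j) / (3 * j) = ((i - j) / j) / 3 := by field_simp
  rw [h, h2]
  have h3 : 1 + (i - j) / j / 3 ≤ √(1 + (i - j) / j) := by
    refine Real.le_sqrt_of_sq_le ?_
    nlinarith
  linarith

lemma third_le_exp_neg_one : (1 : ℝ) / 3 ≤ Real.exp (-1) := by
  rw [Real.exp_neg, one_div]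
  exact inv_anti₀ (Real.exp_pos _) (by have := Real.exp_one_lt_d9; linarith)

/-- Separation of the nodes `exp (-g i / g j)`. -/
lemma node_separation {g : ℕ → ℝ} (hgpos : ∀ i, 0 < i → 0 < g i)
    (hreg : ∀ i j : ℕ, i ≤ j → g i * √j ≤ g j * √i) {n i j : ℕ} (hnj : n ≤ j)
    (hj : j < 2 * n) (hi : i < 2 * n) :
    |(i : ℝ) - j| / (36 * n) ≤ |Real.exp (-(1 / g j)) ^ g j - Real.exp (-(1 / g j)) ^ g i| := by
  have hj0 : 0 < j := by omega
  have hjr : (0 : ℝ) < j := by exact_mod_cast hj0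
  have hn : (0 : ℝ) < n := by exact_mod_cast (by omega : 0 < n)
  have hjn : (j : ℝ) ≤ 2 * n := by exact_mod_cast hj.le
  have hgj := hgpos j hj0
  have hsj := Real.sqrt_pos.2 hjr
  rw [← Real.exp_mul, ← Real.exp_mul]
  -- The ratio `exp (-1 / g j)` puts the node of index `j` at `exp (-1)`. Regularity compares `g i /
  -- g j` with `√(i / j)`, which separates the other nodes from it linearly in `|i - j| / n`; for `i
  -- > j` the bound `i ≤ 2 * j` is needed.
  have e1 : -(1 / g j) * g j = -1 := by field_simp
  have e2 : -(1 / g j) * g i = -1 + (1 - g i / g j) := by field_simp; ring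
  rw [e1, e2, Real.exp_add]
  have h3 := third_le_exp_neg_one
  set E := Real.exp (-1) with hE
  have hfac : E - E * Real.exp (1 - g i / g j) = E * (1 - Real.exp (1 - g i / g j)) := by ring
  rw [hfac, abs_mul, abs_of_pos (Real.exp_pos _)]
  have hcomp : |(i : ℝ) - j| / (36 * n) ≤ 1 / 3 * (|(i : ℝ) - j| / (6 * j)) := by
    rw [mul_div_assoc', div_le_div_iff₀ (by positivity) (by positivity)]
    nlinarith [mul_nonneg (abs_nonneg ((i : ℝ) - j)) (sub_nonneg.2 hjn)]
  refine hcomp.trans (mul_le_mul h3 ?_ (by positivity) (by positivity))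
  rcases le_total i j with hij | hij
  · have hijr : (i : ℝ) ≤ j := by exact_mod_cast hij
    have h4 : g i / g j ≤ √i / √j := by
      rw [div_le_div_iff₀ hgj hsj, mul_comm (√(i : ℝ))]; exact hreg i j hij
    have h5 := sub_div_le_one_sub_sqrt_div (Nat.cast_nonneg i) hjr
    have h6 := Real.add_one_le_exp (1 - g i / g j)
    have h7 : 0 ≤ ((j : ℝ) - i) / (2 * j) := div_nonneg (by linarith) (by positivity)
    rw [abs_sub_comm, abs_of_nonneg (sub_nonneg.2 hijr), abs_sub_comm,
      abs_of_nonneg (by linarith)]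
    have h8 : ((j : ℝ) - i) / (6 * j) = ((j : ℝ) - i) / (2 * j) / 3 := by field_simp; ring
    rw [h8]
    linarith
  · have hijr : (j : ℝ) ≤ i := by exact_mod_cast hij
    have hi2 : (i : ℝ) ≤ 2 * j := by
      have : i ≤ 2 * j := by omega
      exact_mod_cast this
    have h4 : √i / √j ≤ g i / g j := by
      rw [div_le_div_iff₀ hsj hgj, mul_comm (√(i : ℝ))]; exact hreg j i hij
    have h5 := sub_div_le_sqrt_div_sub_one hjr hijr hi2
    set v := ((i : ℝ) - j) / (3 * j) with hv
    have hv0 : 0 ≤ v := div_nonneg (by linarith) (by positivity)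
    have hv1 : v ≤ 1 := by rw [hv, div_le_one (by positivity)]; linarith
    have h6 : Real.exp (1 - g i / g j) ≤ Real.exp (-v) := Real.exp_le_exp.2 (by linarith)
    have h7 : Real.exp (-v) ≤ 1 / (1 + v) := by
      rw [Real.exp_neg, ← one_div]
      exact one_div_le_one_div_of_le (by linarith) (by have := Real.add_one_le_exp v; linarith)
    have h8 : 1 / (1 + v) ≤ 1 - v / 2 := by
      rw [div_le_iff₀ (by linarith)]; nlinarith
    rw [abs_of_nonneg (sub_nonneg.2 hijr), abs_of_nonneg (by linarith)]
    have h9 : ((i : ℝ) - j) / (6 * j) = v / 2 := by rw [hv]; field_simp; ring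
    rw [h9]
    linarith

/-- Node separation reduces the product to the one for equally spaced nodes, a single summand of
`(144 * n) ^ N / N!` with `N + 1 = 2 * n`. -/
lemma prod_node_le {g : ℕ → ℝ} (hgpos : ∀ i, 0 < i → 0 < g i)
    (hreg : ∀ i j : ℕ, i ≤ j → g i * √j ≤ g j * √i) {n j : ℕ} (hnj : n ≤ j) (hj : j < 2 * n) :
    ∏ i ∈ (Finset.range (2 * n)).erase j,
      2 / |Real.exp (-(1 / g j)) ^ g j - Real.exp (-(1 / g j)) ^ g i| ≤ Real.exp (144 * n) := by
  obtain ⟨N, hN⟩ : ∃ N, 2 * n = N + 1 := ⟨2 * n - 1, by omega⟩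
  have hn : (0 : ℝ) < n := by exact_mod_cast (by omega : 0 < n)
  have h1 : ∏ i ∈ (Finset.range (2 * n)).erase j,
      2 / |Real.exp (-(1 / g j)) ^ g j - Real.exp (-(1 / g j)) ^ g i| ≤
      ∏ i ∈ (Finset.range (2 * n)).erase j, (72 * n) / |(i : ℝ) - j| := by
    refine Finset.prod_le_prod (fun _ _ => by positivity) fun i hi => ?_
    have hij := Finset.ne_of_mem_erase hi
    have hi' := Finset.mem_range.1 (Finset.mem_of_mem_erase hi)
    have hd : 0 < |(i : ℝ) - j| := abs_pos.2 (sub_ne_zero.2 (by exact_mod_cast hij))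
    calc _ ≤ 2 / (|(i : ℝ) - j| / (36 * n)) :=
          div_le_div_of_nonneg_left (by norm_num) (by positivity)
            (node_separation hgpos hreg hnj hj hi')
      _ = _ := by field_simp; norm_num
  refine h1.trans ?_
  rw [hN]
  have h2 : ∏ i ∈ (Finset.range (N + 1)).erase j, (72 * (n : ℝ)) / |(i : ℝ) - j| ≤
      ∑ k ∈ Finset.range (N + 1), ∏ i ∈ (Finset.range (N + 1)).erase k, (72 * (n : ℝ)) / |(i : ℝ) - k| :=
    Finset.single_le_sum
      (f := fun k : ℕ => ∏ i ∈ (Finset.range (N + 1)).erase k, (72 * (n : ℝ)) / |(i : ℝ) - k|)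
      (fun k _ => Finset.prod_nonneg fun _ _ => by positivity)
      (Finset.mem_range.2 (by omega))
  refine h2.trans ?_
  rw [sum_prod_erase_div_abs_sub]
  refine (Real.pow_div_factorial_le_exp _ (by positivity) N).trans (le_of_eq ?_)
  ring_nf

/-- The upper half of the terms is small to the left of a set on which the sum is bounded. -/
lemma sum_upper_half_le {g : ℕ → ℝ} (hg : StrictMono g) (hg0 : g 0 = 0)
    (hreg : ∀ i j : ℕ, i ≤ j → g i * √j ≤ g j * √i) {c : ℝ} (hc : 0 < c) (hc1 : c ≤ 1)
    (hcg : ∀ i : ℕ, c * i ≤ g i) {s η K : ℝ} (hs : 0 < s) (hη : 0 < η)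
    (hK : 2 ≤ K) (hηK : 149 + 128 / s ≤ η * K) {n : ℕ} (hn : 0 < n) {a : ℕ → ℝ}
    {y' y'' b : ℝ} (hy' : s ≤ y') (hy'' : y'' ≤ 1) (hδs : K * n / g n ≤ s / 2) {E : Set ℝ}
    (hE : E ⊆ Set.Ioc y' y'') (hvol : ENNReal.ofReal (K * n / g n) ≤ volume E)
    (hb : ∀ x ∈ E, |muntzSum (2 * n) a g x| ≤ b) {x : ℝ} (hx : 0 < x)
    (hxy : x ≤ y' - η * (y'' - y')) :
    ∑ j ∈ Finset.Ico n (2 * n), |a j * x ^ g j| ≤ b * Real.exp (-(2 * n)) := by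
  have hgpos : ∀ i, 0 < i → 0 < g i := fun i hi => by rw [← hg0]; exact hg hi
  have hgnn : ∀ i, 0 ≤ g i := fun i => by rw [← hg0]; exact hg.monotone (Nat.zero_le i)
  have hn' : (1 : ℝ) ≤ n := by exact_mod_cast hn
  have hgn := hgpos n hn
  set δ := K * n / g n with hδ
  have hδ0 : 0 < δ := by positivity
  set l := y'' - y' with hl
  have hlδ : δ ≤ l := by
    have h1 := hvol.trans (measure_mono hE)
    rw [Real.volume_Ioc] at h1
    rcases le_or_gt (y'' - y') 0 with h2 | h2
    · rw [ENNReal.ofReal_of_nonpos h2, nonpos_iff_eq_zero, ENNReal.ofReal_eq_zero] at h1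
      linarith
    · exact (ENNReal.ofReal_le_ofReal_iff h2.le).1 h1
  have hl0 : 0 < l := hδ0.trans_le hlδ
  have hl1 : l ≤ 1 := by rw [hl]; linarith
  have hb0 : 0 ≤ b := by
    have hne : E.Nonempty := by
      rw [Set.nonempty_iff_ne_empty]
      rintro rfl
      rw [measure_empty, nonpos_iff_eq_zero, ENNReal.ofReal_eq_zero] at hvol
      linarith
    exact (abs_nonneg _).trans (hb _ hne.some_mem)
  have hy'0 : 0 < y' := hs.trans_le hy'
  obtain ⟨N, hN⟩ : ∃ N, 2 * n = N + 1 := ⟨2 * n - 1, by omega⟩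
  have hNr : (N : ℝ) + 1 = 2 * n := by exact_mod_cast hN.symm
  set R := l / δ with hR
  have hR1 : 1 ≤ R := by rw [hR, one_le_div hδ0]; exact hlδ
  -- values slightly to the left of `y'`
  have hwin : ∀ t, y' - δ ≤ t → t ≤ y' →
      |muntzSum (2 * n) a g t| ≤ Real.exp (2 * n * R + 128 / s * n) * b := by
    intro t ht1 ht2
    have hts : s / 2 ≤ t := by linarith
    have ht0 : 0 < t := by linarith
    -- For `u ∈ E` one has `u - t ≤ 2 * l` and `t ≥ s / 2`, whence `B = 4 * l / s`.
    have h1 := abs_muntzSum_le_of_measure (N := N) (a := a) (e := g) (B := 4 * l / s) (y := t) hg hc hc1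
      hcg ht0 hδ0 (fun u hu => ⟨ht2.trans_lt (hE hu).1, (hE hu).2.trans hy''⟩) hvol
      (fun u hu => by
        refine (rpow_sub_le_mul_div hc hc1 ht0 (ht2.trans (hE hu).1.le) (by linarith)).trans ?_
        refine mul_le_mul_of_nonneg_left ?_ hc.le
        rw [div_le_div_iff₀ ht0 hs]
        have h2 := (hE hu).2
        have h3 : u - t ≤ 2 * l := by rw [hl] at hlδ ⊢; linarith
        nlinarith [mul_le_mul_of_nonneg_right h3 hs.le])
      (by rw [← hN]; exact hb)
    rw [← hN, hNr] at h1
    refine h1.trans (mul_le_mul_of_nonneg_right ?_ hb0)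
    have h2 : 4 * (2 * n) * (4 * l / s) / δ = R * (32 * n / s) := by rw [hR]; field_simp; norm_num
    rw [h2, mul_pow, mul_div_assoc, Real.exp_add]
    refine mul_le_mul ?_ ?_ (by positivity) (Real.exp_pos _).le
    · have h3 : R ≤ Real.exp R := by have := Real.add_one_le_exp R; linarith
      calc R ^ N ≤ Real.exp R ^ N := by gcongr
        _ = Real.exp (N * R) := by rw [← Real.exp_nat_mul]
        _ ≤ _ := Real.exp_le_exp.2 (by nlinarith)
    · refine (Real.pow_div_factorial_le_exp _ (by positivity) N).trans (Real.exp_le_exp.2 ?_)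
      rw [mul_div_right_comm, mul_comm]
      have h4 : (n : ℝ) * (32 / s) ≤ n * (128 / s) := by gcongr; norm_num
      linarith
  have hcoef : ∀ j ∈ Finset.Ico n (2 * n), |a j| * y' ^ g j ≤
      Real.exp (2 * n * R + 128 / s * n) * b * Real.exp (144 * n) := by
    intro j hj
    obtain ⟨hj1, hj2⟩ := Finset.mem_Ico.1 hj
    have hgj := hgpos j (by omega)
    have hρ1 : Real.exp (-(1 / g j)) ≤ 1 := by
      rw [Real.exp_le_one_iff]; have := one_div_pos.2 hgj; linarith
    refine (abs_coeff_mul_rpow_le (ρ := Real.exp (-(1 / g j)))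
      (M := Real.exp (2 * n * R + 128 / s * n) * b) hj2 hy'0 (Real.exp_pos _) hρ1 hgnn ?_ ?_).trans ?_
    -- The points `y' * exp (-t / g j)` stay within `2 * n / g n ≤ δ` of `y'`; this is where `2 ≤ K`
    -- is used.
    · intro t ht
      refine hwin _ ?_ ?_
      · rw [← Real.exp_nat_mul]
        have h1 := Real.add_one_le_exp ((t : ℝ) * -(1 / g j))
        have h2 : (t : ℝ) * (1 / g j) ≤ δ := by
          have h3 : (t : ℝ) ≤ 2 * n := by exact_mod_cast ht.le
          have h4 : g n ≤ g j := hg.monotone hj1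
          rw [hδ, mul_one_div]
          refine div_le_div₀ (by positivity) (h3.trans ?_) hgn h4
          nlinarith
        have h5 : 0 ≤ (t : ℝ) * (1 / g j) := by positivity
        have hy1 : y' ≤ 1 := by linarith
        nlinarith
      · exact mul_le_of_le_one_right hy'0.le (pow_le_one₀ (Real.exp_pos _).le hρ1)
    · intro i hi hij h
      have h1 := node_separation hgpos hreg hj1 hj2 hi
      rw [h, sub_self, abs_zero] at h1
      have h2 : 0 < |(i : ℝ) - j| := abs_pos.2 (sub_ne_zero.2 (by exact_mod_cast hij))
      have h3 : 0 < |(i : ℝ) - j| / (36 * n) := by positivity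
      linarith
    · exact mul_le_mul_of_nonneg_left (prod_node_le hgpos hreg hj1 hj2) (by positivity)
  have hterm : ∀ j ∈ Finset.Ico n (2 * n), |a j * x ^ g j| ≤
      b * Real.exp (2 * n * R + 128 / s * n + 144 * n - η * K * n * R) := by
    intro j hj
    obtain ⟨hj1, hj2⟩ := Finset.mem_Ico.1 hj
    have hgj := hgpos j (by omega)
    -- As `y' ≤ 1`, the shift by `η * l` gives `x / y' ≤ 1 - η * l`.
    have hratio : x / y' ≤ Real.exp (-(η * l)) := by
      rw [div_le_iff₀ hy'0]
      have h1 := Real.add_one_le_exp (-(η * l))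
      have hy1 : y' ≤ 1 := by linarith
      have h2 : 0 < η * l := by positivity
      nlinarith
    have h1 : (x / y') ^ g j ≤ Real.exp (-(η * K * n * R)) := by
      calc (x / y') ^ g j ≤ Real.exp (-(η * l)) ^ g j :=
            Real.rpow_le_rpow (by positivity) hratio hgj.le
        _ = Real.exp (-(η * l) * g j) := by rw [← Real.exp_mul]
        _ ≤ _ := by
          rw [Real.exp_le_exp]
          have h2 : K * n * R = l * g n := by rw [hR, hδ]; field_simp
          have h3 : g n ≤ g j := hg.monotone hj1
          have h4 : 0 < η * l := by positivity
          have h5 : η * K * n * R = η * l * g n := by rw [mul_assoc η, mul_assoc η, h2]; ring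
          rw [h5]
          nlinarith
    have h2 : |a j * x ^ g j| = (|a j| * y' ^ g j) * (x / y') ^ g j := by
      rw [abs_mul, abs_of_pos (Real.rpow_pos_of_pos hx _), Real.div_rpow hx.le hy'0.le]
      have := (Real.rpow_pos_of_pos hy'0 (g j)).ne'
      field_simp
    rw [h2]
    refine (mul_le_mul (hcoef j hj) h1 (by positivity) (by positivity)).trans (le_of_eq ?_)
    simp only [sub_eq_add_neg, Real.exp_add]
    ring
  refine (Finset.sum_le_card_nsmul _ _ _ hterm).trans ?_
  rw [Nat.card_Ico, nsmul_eq_mul]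
  have h1 : ((2 * n - n : ℕ) : ℝ) ≤ Real.exp n := by
    have : 2 * n - n = n := by omega
    rw [this]
    have := Real.add_one_le_exp (n : ℝ)
    linarith
  calc _ ≤ Real.exp n * (b * Real.exp (2 * n * R + 128 / s * n + 144 * n - η * K * n * R)) := by
        gcongr
    _ = b * Real.exp (n + (2 * n * R + 128 / s * n + 144 * n - η * K * n * R)) := by
        rw [Real.exp_add n]; ring
    _ ≤ _ := by
      refine mul_le_mul_of_nonneg_left (Real.exp_le_exp.2 ?_) hb0
      have h2 : 0 < 128 / s := by positivity
      have h4 : (n : ℝ) ≤ n * R := le_mul_of_one_le_right (by linarith) hR1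
      -- The constant collects `1` from the number of terms, `2` and `128 / s` from the window to
      -- the left of `y'`, `144` from the nodes, and `2` for the claimed decay.
      have h3 : (149 + 128 / s) * (n * R) ≤ η * K * (n * R) :=
        mul_le_mul_of_nonneg_right hηK (by linarith)
      have h5 : 128 / s * n ≤ 128 / s * (n * R) := mul_le_mul_of_nonneg_left h4 h2.le
      rw [add_mul] at h3
      have h6 : 2 * n * R = 2 * (n * R) := by ring
      have h7 : η * K * n * R = η * K * (n * R) := by ring
      rw [h6, h7]
      linarith

/-! ### Outer measure of slices of `A` and dyadic truncation -/

lemma measureReal_inter_Iic_le {A : Set ℝ} {t t' : ℝ} (htt : t ≤ t') :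
    volume.real (A ∩ Set.Iic t') ≤ volume.real (A ∩ Set.Iic t) + volume.real (A ∩ Set.Ioc t t') := by
  have h : A ∩ Set.Iic t' = (A ∩ Set.Iic t) ∪ (A ∩ Set.Ioc t t') := by
    rw [← Set.inter_union_distrib_left, Set.Iic_union_Ioc_eq_Iic htt]
  rw [h]
  exact measureReal_union_le _ _

lemma measureReal_inter_Ioc_le (A : Set ℝ) {t t' : ℝ} (htt : t ≤ t') :
    volume.real (A ∩ Set.Ioc t t') ≤ t' - t := by
  refine (measureReal_mono Set.inter_subset_right (by simp)).trans ?_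
  rw [Real.volume_real_Ioc_of_le htt]

lemma measureReal_inter_Iic_le_self {A : Set ℝ} (hA : A ⊆ Set.Icc 0 1) {t : ℝ} (ht : 0 ≤ t) :
    volume.real (A ∩ Set.Iic t) ≤ t := by
  have h : A ∩ Set.Iic t ⊆ Set.Icc 0 t := fun x hx => ⟨(hA hx.1).1, hx.2⟩
  refine (measureReal_mono h (by simp)).trans ?_
  rw [Real.volume_real_Icc_of_le ht, sub_zero]

/-- Subadditivity makes the function 1-Lipschitz, without measurability of `A`. By the intermediate
value theorem a slice of prescribed outer measure can then be cut off. -/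
lemma continuous_measureReal_inter_Ioc (A : Set ℝ) (u : ℝ) :
    Continuous fun t => volume.real (A ∩ Set.Ioc t u) := by
  refine (LipschitzWith.of_le_add (f := fun t => volume.real (A ∩ Set.Ioc t u)) fun t t' => ?_).continuous
  have hfin : ∀ t, volume (A ∩ Set.Ioc t u) ≠ ⊤ := fun t =>
    ((measure_mono Set.inter_subset_right).trans_lt (by simp : volume (Set.Ioc t u) < ⊤)).ne
  rcases le_total t t' with h | h
  · have hsub : A ∩ Set.Ioc t u ⊆ (A ∩ Set.Ioc t' u) ∪ Set.Ioc t t' := by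
      intro x hx
      rcases le_or_gt x t' with h1 | h1
      · exact Or.inr ⟨hx.2.1, h1⟩
      · exact Or.inl ⟨hx.1, h1, hx.2.2⟩
    refine (measureReal_mono hsub
      ((measure_union_lt_top (hfin t').lt_top (by simp)).ne)).trans ?_
    refine (measureReal_union_le _ _).trans ?_
    rw [Real.volume_real_Ioc_of_le h, Real.dist_eq, abs_sub_comm, abs_of_nonneg (sub_nonneg.2 h)]
  · have h1 : volume.real (A ∩ Set.Ioc t u) ≤ volume.real (A ∩ Set.Ioc t' u) :=
      measureReal_mono (fun x hx => ⟨hx.1, h.trans_lt hx.2.1, hx.2.2⟩) (hfin t')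
    exact h1.trans (le_add_of_nonneg_right dist_nonneg)

lemma exists_measureReal_inter_Ioc_eq {A : Set ℝ} (hA : A ⊆ Set.Ioc 0 1) {u δ : ℝ} (hδ : 0 ≤ δ)
    (hu : 0 ≤ u) (hδu : δ ≤ volume.real (A ∩ Set.Iic u)) :
    ∃ t, 0 ≤ t ∧ t ≤ u ∧ volume.real (A ∩ Set.Ioc t u) = δ := by
  have h0 : A ∩ Set.Ioc 0 u = A ∩ Set.Iic u := by
    ext x
    exact ⟨fun h => ⟨h.1, h.2.2⟩, fun h => ⟨h.1, (hA h.1).1, h.2⟩⟩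
  have h := intermediate_value_Icc' hu (continuous_measureReal_inter_Ioc A u).continuousOn
  simp only [Set.Ioc_self, Set.inter_empty, measureReal_empty, h0] at h
  obtain ⟨t, ht, hte⟩ := h ⟨hδ, hδu⟩
  exact ⟨t, ht.1, ht.2, hte⟩

lemma muntzSum_two_mul (n : ℕ) (a g : ℕ → ℝ) (x : ℝ) :
    muntzSum (2 * n) a g x = muntzSum n a g x + ∑ j ∈ Finset.Ico n (2 * n), a j * x ^ g j :=
  (Finset.sum_range_add_sum_Ico _ (by omega)).symm

/-- Makes the truncation errors at the successive dyadic levels sum geometrically. -/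
lemma two_mul_exp_le (m r : ℕ) :
    2 * Real.exp (-(2 * ((2 ^ (r + m) : ℕ) : ℝ))) ≤ (1 / 2) ^ (m + 1) := by
  have hm : m + 1 ≤ 2 ^ (r + m) :=
    (Nat.lt_two_pow_self (n := m)).trans_le (Nat.pow_le_pow_right (by norm_num) (by omega))
  have hm' : (m : ℝ) + 1 ≤ ((2 ^ (r + m) : ℕ) : ℝ) := by exact_mod_cast hm
  have h1 : Real.exp (-(2 * ((2 ^ (r + m) : ℕ) : ℝ))) ≤ Real.exp (-((m + 2 : ℕ) : ℝ)) := by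
    rw [Real.exp_le_exp]; push_cast at hm' ⊢
    have : (0 : ℝ) ≤ m := Nat.cast_nonneg m
    linarith
  have h2 : Real.exp (-((m + 2 : ℕ) : ℝ)) ≤ (1 / 2) ^ (m + 2) := by
    have h3 : Real.exp (-((m + 2 : ℕ) : ℝ)) = Real.exp (-1) ^ (m + 2) := by
      rw [← Real.exp_nat_mul]; congr 1; ring
    rw [h3]
    refine pow_le_pow_left₀ (Real.exp_pos _).le ?_ _
    rw [Real.exp_neg, one_div]
    exact inv_anti₀ (by norm_num) (by have := Real.add_one_le_exp (1 : ℝ); linarith)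
  have h4 : ((1 : ℝ) / 2) ^ (m + 2) * 2 = (1 / 2) ^ (m + 1) := by rw [pow_succ _ (m + 1)]; ring
  linarith

/-- Truncation of a generalized polynomial, to the left of enough of the set where it is bounded. -/
lemma exists_truncation {g : ℕ → ℝ} (hg : StrictMono g) (hg0 : g 0 = 0)
    (hreg : ∀ i j : ℕ, i ≤ j → g i * √j ≤ g j * √i) {c : ℝ} (hc : 0 < c) (hc1 : c ≤ 1)
    (hcg : ∀ i : ℕ, c * i ≤ g i) {s K : ℝ} (hs : 0 < s)
    (hK : 2 ≤ K) (hsK : 149 + 512 / s ≤ s / 4 * K) {r : ℕ}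
    (hr : ∀ M, ∑ i ∈ Finset.range M, K * (2 ^ (r + i) : ℕ) / g (2 ^ (r + i)) ≤ s / 8)
    {A : Set ℝ} (hA : A ⊆ Set.Ioc 0 1) (hvol : s ≤ volume.real A) (M : ℕ) {a : ℕ → ℝ} {b : ℝ}
    (hb0 : 0 ≤ b) (hb : ∀ x ∈ A, |muntzSum (2 ^ (r + M)) a g x| ≤ b) (d : ℕ) :
    ∀ m, m + d = M → ∃ y, 0 ≤ y ∧ y ≤ 1 ∧
      s - ∑ i ∈ Finset.Ico m M, K * (2 ^ (r + i) : ℕ) / g (2 ^ (r + i)) - s / 4 * (1 - y) ≤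
        volume.real (A ∩ Set.Iic y) ∧
      ∀ x, 0 < x → x ≤ y →
        |muntzSum (2 ^ (r + M)) a g x - muntzSum (2 ^ (r + m)) a g x| ≤ b * (1 / 2) ^ m := by
  have hgpos : ∀ i, 0 < i → 0 < g i := fun i hi => by rw [← hg0]; exact hg hi
  set δ : ℕ → ℝ := fun i => K * (2 ^ (r + i) : ℕ) / g (2 ^ (r + i)) with hδ
  have hδ0 : ∀ i, 0 < δ i := fun i => by
    have := hgpos (2 ^ (r + i)) (by positivity)
    simp only [hδ]
    positivity
  have hsum : ∀ m, ∑ i ∈ Finset.Ico m M, δ i ≤ s / 8 := fun m =>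
    (Finset.sum_le_sum_of_subset_of_nonneg
      (fun i hi => Finset.mem_range.2 (Finset.mem_Ico.1 hi).2) (fun i _ _ => (hδ0 i).le)).trans (hr M)
  have hA01 : A ⊆ Set.Icc 0 1 := hA.trans Set.Ioc_subset_Icc_self
  induction d with
  | zero =>
    intro m hm
    obtain rfl : m = M := by omega
    refine ⟨1, zero_le_one, le_rfl, ?_, fun x _ _ => ?_⟩
    · have : A ∩ Set.Iic 1 = A := Set.inter_eq_left.2 fun x hx => (hA hx).2
      rw [this]
      simpa using hvol
    · rw [sub_self, abs_zero]; positivity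
  | succ d ih =>
    intro m hm
    obtain ⟨u, hu0, hu1, huV, hu⟩ := ih (m + 1) (by omega)
    have hIco : ∑ i ∈ Finset.Ico m M, δ i = δ m + ∑ i ∈ Finset.Ico (m + 1) M, δ i := by
      rw [Finset.sum_eq_sum_Ico_succ_bot (by omega)]
    have hs1 := hsum m
    have hδm : δ m ≤ s / 8 := by
      have : 0 ≤ ∑ i ∈ Finset.Ico (m + 1) M, δ i := Finset.sum_nonneg fun i _ => (hδ0 i).le
      linarith
    have hηu : s / 4 * (1 - u) ≤ s / 4 := by nlinarith
    -- The slice of `A` in `(t, u]` of measure `δ m` plays the role of `E`. Since `A ∩ Iic t` keeps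
    -- measure at least `s / 4`, also `t ≥ s / 4`.
    obtain ⟨t, ht0, htu, ht⟩ := exists_measureReal_inter_Ioc_eq hA (hδ0 m).le hu0
      (by linarith : δ m ≤ volume.real (A ∩ Set.Iic u))
    have h1 := measureReal_inter_Iic_le (A := A) htu
    rw [ht] at h1
    have h2 := measureReal_inter_Iic_le_self hA01 ht0
    have hts : s / 4 ≤ t := by linarith
    -- The margin is proportional to `u - t`, so over all levels the margins add up to at most `s /
    -- 4 * (1 - y)`, as the measure invariant records.
    set y := t - s / 4 * (u - t) with hy
    have hyt : y ≤ t := by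
      rw [hy]; have : 0 ≤ s / 4 * (u - t) := mul_nonneg (by linarith) (by linarith)
      linarith
    have h3 := measureReal_inter_Iic_le (A := A) hyt
    have h4 := measureReal_inter_Ioc_le A hyt
    have hty : t - y = s / 4 * (u - t) := by rw [hy]; ring
    have hV : s - ∑ i ∈ Finset.Ico m M, δ i - s / 4 * (1 - y) ≤ volume.real (A ∩ Set.Iic y) := by
      rw [hIco]
      nlinarith
    have hy0 : 0 ≤ y := by
      have : s / 4 * (u - t) ≤ s / 4 := by nlinarith
      linarith
    refine ⟨y, hy0, by linarith, hV, fun x hx hxy => ?_⟩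
    set n := 2 ^ (r + m) with hn
    have h2n : 2 ^ (r + (m + 1)) = 2 * n := by rw [hn, ← add_assoc, pow_succ, mul_comm]
    rw [h2n] at hu
    have hfin : volume (A ∩ Set.Ioc t u) ≠ ⊤ :=
      ((measure_mono Set.inter_subset_right).trans_lt (by simp : volume (Set.Ioc t u) < ⊤)).ne
    -- On `A` to the left of `u` the sum with `2 * n` terms differs from the full one by at most
    -- `b`, so it is bounded by `2 * b`.
    have hup := sum_upper_half_le hg hg0 hreg hc hc1 hcg (s := s / 4) (η := s / 4) (K := K)
      (by linarith) (by linarith) hK (by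
        have : 128 / (s / 4) = 512 / s := by field_simp; norm_num
        rw [this]; exact hsK) (n := n) (by positivity) (a := a)
      (y' := t) (y'' := u) (b := 2 * b) hts hu1 (by have : δ m = K * n / g n := rfl; linarith)
      (E := A ∩ Set.Ioc t u) Set.inter_subset_right
      (by
        rw [ENNReal.ofReal_le_iff_le_toReal hfin]
        exact ht.ge)
      (fun x hx => by
        have h5 := hu x (hA hx.1).1 hx.2.2
        have h6 := hb x hx.1
        have h7 : ((1 : ℝ) / 2) ^ (m + 1) ≤ 1 := pow_le_one₀ (by norm_num) (by norm_num)
        have h8 := abs_sub_abs_le_abs_sub (muntzSum (2 * n) a g x) (muntzSum (2 ^ (r + M)) a g x)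
        rw [abs_sub_comm] at h8
        nlinarith)
      hx hxy
    have h5 := hu x hx (hxy.trans (hyt.trans htu))
    have h6 : |muntzSum (2 * n) a g x - muntzSum n a g x| ≤ 2 * b * Real.exp (-(2 * n)) := by
      rw [muntzSum_two_mul, add_sub_cancel_left]
      exact (Finset.abs_sum_le_sum_abs _ _).trans hup
    have h7 := two_mul_exp_le m r
    rw [← hn] at h7
    have h8 : 2 * b * Real.exp (-(2 * n)) ≤ b * (1 / 2) ^ (m + 1) := by
      calc _ = b * (2 * Real.exp (-(2 * n))) := by ring
        _ ≤ _ := mul_le_mul_of_nonneg_left h7 hb0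
    have h9 : b * ((1 : ℝ) / 2) ^ m = b * (1 / 2) ^ (m + 1) + b * (1 / 2) ^ (m + 1) := by
      rw [pow_succ]; ring
    rw [h9]
    exact (abs_sub_le _ _ _).trans (add_le_add h5 (h6.trans h8))

/-- Cauchy condensation: `∑ 2 ^ k / g (2 ^ k)` converges together with `∑ 1 / g i`, and `r` is
chosen to make its tail small. -/
lemma exists_sum_dyadic_le {g : ℕ → ℝ} (hg : StrictMono g) (hg0 : g 0 = 0)
    (hsum : Summable fun i => 1 / g i) (K : ℝ) {ε : ℝ} (hε : 0 < ε) (hK : 0 ≤ K) :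
    ∃ r : ℕ, ∀ M, ∑ i ∈ Finset.range M, K * (2 ^ (r + i) : ℕ) / g (2 ^ (r + i)) ≤ ε := by
  have hgnn : ∀ i, 0 ≤ g i := fun i => by rw [← hg0]; exact hg.monotone (Nat.zero_le i)
  have h1 : Summable fun k : ℕ => (2 : ℝ) ^ k * (1 / g (2 ^ k)) := by
    rw [summable_condensed_iff_of_nonneg (f := fun i => 1 / g i)]
    · exact hsum
    · exact fun i => one_div_nonneg.2 (hgnn i)
    · intro m n hm hmn
      exact one_div_le_one_div_of_le (by rw [← hg0]; exact hg hm) (hg.monotone hmn)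
  have h2 : Summable fun k : ℕ => K * (2 ^ k : ℕ) / g (2 ^ k) := by
    refine (h1.mul_left K).congr fun k => ?_
    push_cast; ring
  have h3 := tendsto_sum_nat_add fun k : ℕ => K * (2 ^ k : ℕ) / g (2 ^ k)
  obtain ⟨r, hr⟩ := (h3.eventually (gt_mem_nhds hε)).exists
  refine ⟨r, fun M => le_trans ?_ hr.le⟩
  have h4 := ((summable_nat_add_iff r).2 h2).sum_le_tsum (Finset.range M)
    (fun i _ => by have := hgnn (2 ^ (i + r)); positivity)
  refine le_trans (le_of_eq ?_) h4
  exact Finset.sum_congr rfl fun i _ => by rw [add_comm r i]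

/-- The bounded Remez-type inequality for exponents with `g i / √i` nondecreasing. -/
lemma remez_of_regular {g : ℕ → ℝ} (hg : StrictMono g) (hg0 : g 0 = 0)
    (hreg : ∀ i j : ℕ, i ≤ j → g i * √j ≤ g j * √i) {c : ℝ} (hc : 0 < c) (hc1 : c ≤ 1)
    (hcg : ∀ i : ℕ, c * i ≤ g i) (hsum : Summable fun i => 1 / g i) {s : ℝ} (hs : 0 < s) :
    ∃ C : ℝ, 0 ≤ C ∧ ∀ ϱ : ℝ, 0 < ϱ → ∀ A : Set ℝ, A ⊆ Set.Icc ϱ 1 → s ≤ volume.real A →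
      ∀ (N : ℕ) (a : ℕ → ℝ) (b : ℝ), (∀ x ∈ A, |muntzSum N a g x| ≤ b) →
        ∀ x, 0 < x → x ≤ ϱ → |muntzSum N a g x| ≤ C * b := by
  obtain ⟨K, hK, hsK⟩ : ∃ K : ℝ, 2 ≤ K ∧ 149 + 512 / s ≤ s / 4 * K := by
    refine ⟨max 2 ((149 + 512 / s) / (s / 4)), le_max_left _ _, ?_⟩
    calc 149 + 512 / s = s / 4 * ((149 + 512 / s) / (s / 4)) := by field_simp
      _ ≤ _ := mul_le_mul_of_nonneg_left (le_max_right _ _) (by linarith)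
  obtain ⟨r, hr⟩ := exists_sum_dyadic_le hg hg0 hsum K (by linarith : 0 < s / 8) (by linarith)
  obtain ⟨n, hn⟩ : ∃ n, 2 ^ r = n + 1 := ⟨2 ^ r - 1, by have := Nat.two_pow_pos r; omega⟩
  refine ⟨(4 * (n + 1) * (1 / c) / (s / 2)) ^ n / n.factorial * 2 + 1, by positivity, ?_⟩
  intro ϱ hϱ A hA hvol N a b hb x hx hxϱ
  have hA' : A ⊆ Set.Ioc 0 1 := fun t ht => ⟨hϱ.trans_le (hA ht).1, (hA ht).2⟩
  have hb0 : 0 ≤ b := by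
    have hne : A.Nonempty := by
      rw [Set.nonempty_iff_ne_empty]
      rintro rfl
      rw [measureReal_empty] at hvol
      linarith
    exact (abs_nonneg _).trans (hb _ hne.some_mem)
  obtain ⟨M, hM⟩ : ∃ M, N ≤ 2 ^ (r + M) :=
    ⟨N, (Nat.lt_two_pow_self (n := N)).le.trans (Nat.pow_le_pow_right (by norm_num) (by omega))⟩
  -- Padding by zeros brings the number of terms to `2 ^ (r + M)`.
  set a' : ℕ → ℝ := fun i => if i < N then a i else 0 with ha'
  have hpad : ∀ t, muntzSum (2 ^ (r + M)) a' g t = muntzSum N a g t := by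
    intro t
    rw [muntzSum, ← Finset.sum_range_add_sum_Ico _ hM, Finset.sum_eq_zero (s := Finset.Ico _ _), add_zero]
    · exact Finset.sum_congr rfl fun i hi => by simp [ha', Finset.mem_range.1 hi]
    · intro i hi
      have := (Finset.mem_Ico.1 hi).1
      simp [ha', not_lt.2 this]
  obtain ⟨y, hy0, hy1, hyV, hy⟩ := exists_truncation hg hg0 hreg hc hc1 hcg hs hK hsK hr hA' hvol M
    hb0 (a := a') (fun t ht => by rw [hpad]; exact hb t ht) M 0 (zero_add M)
  -- The truncation costs at most `s / 8` for the slices and `s / 4` for the margins.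
  have hV : s / 2 ≤ volume.real (A ∩ Set.Iic y) := by
    have h1 := hr M
    rw [Finset.range_eq_Ico] at h1
    nlinarith
  have hfin : volume (A ∩ Set.Ioc ϱ y) ≠ ⊤ :=
    ((measure_mono Set.inter_subset_right).trans_lt (by simp : volume (Set.Ioc ϱ y) < ⊤)).ne
  have hV2 : s / 2 ≤ volume.real (A ∩ Set.Ioc ϱ y) := by
    have hsub : A ∩ Set.Iic y ⊆ (A ∩ Set.Ioc ϱ y) ∪ {ϱ} := by
      intro t ht
      rcases (hA ht.1).1.eq_or_lt with h | h
      · exact Or.inr h.symm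
      · exact Or.inl ⟨ht.1, h, ht.2⟩
    have h1 := (measureReal_mono hsub (measure_union_lt_top hfin.lt_top (by simp)).ne).trans
      (measureReal_union_le _ _)
    have h2 : volume.real ({ϱ} : Set ℝ) = 0 := by simp [Measure.real]
    rw [h2, add_zero] at h1
    exact hV.trans h1
  have hϱy : ϱ ≤ y := by
    have hne : (A ∩ Set.Ioc ϱ y).Nonempty := by
      rw [Set.nonempty_iff_ne_empty]
      intro h
      rw [h, measureReal_empty] at hV2
      linarith
    obtain ⟨t, ht⟩ := hne
    exact ht.2.1.le.trans ht.2.2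
  simp only [hpad, add_zero, pow_zero, mul_one, hn] at hy
  have hrem := abs_muntzSum_le_of_measure (N := n) (a := a') (e := g) (B := 1 / c) (b := 2 * b)
    hg hc hc1 hcg hx (by linarith : 0 < s / 2) (E := A ∩ Set.Ioc ϱ y)
    (fun t ht => ⟨hxϱ.trans_lt ht.2.1, ht.2.2.trans hy1⟩)
    (by rw [ENNReal.ofReal_le_iff_le_toReal hfin]; exact hV2)
    (fun t ht => by
      have h1 : t ^ c ≤ 1 := Real.rpow_le_one (hA' ht.1).1.le (hA' ht.1).2 hc.le
      have h2 : 0 ≤ x ^ c := (Real.rpow_pos_of_pos hx c).le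
      have h3 : c * (1 / c) = 1 := by field_simp
      linarith)
    (fun t ht => by
      have h1 := hy t (hA' ht.1).1 ht.2.2
      have h2 := hb t ht.1
      have h3 := abs_sub_abs_le_abs_sub (muntzSum (n + 1) a' g t) (muntzSum N a g t)
      rw [abs_sub_comm] at h3
      linarith)
  have h1 := hy x hx (hxϱ.trans hϱy)
  have h2 := abs_sub_abs_le_abs_sub (muntzSum N a g x) (muntzSum (n + 1) a' g x)
  calc |muntzSum N a g x| ≤ |muntzSum (n + 1) a' g x| + b := by linarith
    _ ≤ (4 * (n + 1) * (1 / c) / (s / 2)) ^ n / n.factorial * (2 * b) + b := by linarith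
    _ = _ := by ring

/-! ### Duality: passing from smaller to larger exponents -/

/-- A linear combination can be rewritten with at most `finrank` terms without increasing the sum
of the absolute values of its coefficients. -/
lemma exists_card_le_finrank {ι V : Type*} [DecidableEq ι] [AddCommGroup V] [Module ℝ V]
    [FiniteDimensional ℝ V] (v : ι → V) (n : ℕ) : ∀ (T : Finset ι) (c : ι → ℝ), T.card = n →
    ∃ T' ⊆ T, ∃ c' : ι → ℝ, T'.card ≤ Module.finrank ℝ V ∧
      ∑ x ∈ T', |c' x| ≤ ∑ x ∈ T, |c x| ∧ ∑ x ∈ T', c' x • v x = ∑ x ∈ T, c x • v x := by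
  induction n with
  | zero =>
    intro T c hT
    exact ⟨T, Finset.Subset.refl _, c, by omega, le_rfl, rfl⟩
  | succ n ih =>
    intro T c hT
    by_cases hcard : T.card ≤ Module.finrank ℝ V
    · exact ⟨T, Finset.Subset.refl _, c, hcard, le_rfl, rfl⟩
    -- it suffices to find an equivalent combination with a vanishing coefficient
    suffices h : ∃ c₁ : ι → ℝ, ∑ x ∈ T, |c₁ x| ≤ ∑ x ∈ T, |c x| ∧
        ∑ x ∈ T, c₁ x • v x = ∑ x ∈ T, c x • v x ∧ ∃ x ∈ T, c₁ x = 0 by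
      obtain ⟨c₁, h1, h2, x, hx, hx0⟩ := h
      obtain ⟨T', hT', c', h3, h4, h5⟩ := ih (T.erase x) c₁ (by
        rw [Finset.card_erase_of_mem hx, hT]; rfl)
      refine ⟨T', hT'.trans (Finset.erase_subset _ _), c', h3, ?_, ?_⟩
      · refine h4.trans (le_trans ?_ h1)
        exact Finset.sum_le_sum_of_subset_of_nonneg (Finset.erase_subset _ _)
          fun _ _ _ => abs_nonneg _
      · rw [h5, ← h2, ← Finset.add_sum_erase T _ hx, hx0, zero_smul, zero_add]
    by_cases hzero : ∃ x ∈ T, c x = 0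
    · exact ⟨c, le_rfl, rfl, hzero⟩
    push Not at hzero
    have hdep : ¬ LinearIndependent ℝ (fun x : T => v x) := by
      intro h
      have := h.fintype_card_le_finrank
      rw [Fintype.card_coe] at this
      exact hcard this
    rw [Fintype.not_linearIndependent_iff] at hdep
    obtain ⟨e, he, x₁, hx₁⟩ := hdep
    -- A linear relation, with its sign chosen so that moving the coefficients along it does not
    -- increase the sum of their absolute values to first order.
    obtain ⟨d, hd0, hdne, hdσ⟩ : ∃ d : ι → ℝ, ∑ x ∈ T, d x • v x = 0 ∧ (∃ x ∈ T, d x ≠ 0) ∧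
        ∑ x ∈ T, SignType.sign (c x) * d x ≤ 0 := by
      set d : ι → ℝ := fun x => if h : x ∈ T then e ⟨x, h⟩ else 0 with hd
      have h0 : ∑ x ∈ T, d x • v x = 0 := by
        rw [← Finset.sum_coe_sort, ← he]
        refine Finset.sum_congr rfl fun x _ => ?_
        simp [hd]
      have h1 : d x₁ ≠ 0 := by simpa [hd] using hx₁
      rcases le_total (∑ x ∈ T, (SignType.sign (c x) : ℝ) * d x) 0 with h | h
      · exact ⟨d, h0, ⟨x₁, x₁.2, h1⟩, h⟩
      · refine ⟨fun x => -d x, ?_, ⟨x₁, x₁.2, neg_ne_zero.2 h1⟩, ?_⟩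
        · simp [h0]
        · simpa using h
    set S := T.filter fun x => (SignType.sign (c x) : ℝ) * d x < 0 with hS
    have hSne : S.Nonempty := by
      by_contra hcon
      rw [Finset.not_nonempty_iff_eq_empty, hS, Finset.filter_eq_empty_iff] at hcon
      have hnn : ∀ x ∈ T, 0 ≤ (SignType.sign (c x) : ℝ) * d x := fun x hx => not_lt.1 (hcon hx)
      have h1 := (Finset.sum_eq_zero_iff_of_nonneg hnn).1
        (le_antisymm hdσ (Finset.sum_nonneg hnn))
      obtain ⟨x, hx, hdx⟩ := hdne
      rcases mul_eq_zero.1 (h1 x hx) with h2 | h2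
      · rcases lt_or_gt_of_ne (hzero x hx) with h3 | h3
        · rw [sign_neg h3] at h2; norm_num at h2
        · rw [sign_pos h3] at h2; norm_num at h2
      · exact hdx h2
    obtain ⟨x₀, hx₀S, hmin⟩ := S.exists_min_image (fun x => |c x| / |d x|) hSne
    have hx₀T : x₀ ∈ T := (Finset.mem_filter.1 hx₀S).1
    have hx₀d := (Finset.mem_filter.1 hx₀S).2
    -- The first time at which a coefficient reaches zero. Until then no coefficient changes sign,
    -- so the first-order computation is exact.
    set t := |c x₀| / |d x₀| with ht
    have ht0 : 0 ≤ t := by positivity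
    have hsgn : ∀ x ∈ T, ((SignType.sign (c x) : ℝ)) * c x = |c x| := fun x _ => sign_mul_self (c x)
    have hsgn1 : ∀ x ∈ T, |((SignType.sign (c x) : ℝ))| = 1 := by
      intro x hx
      rcases lt_or_gt_of_ne (hzero x hx) with h3 | h3
      · rw [sign_neg h3]; norm_num
      · rw [sign_pos h3]; norm_num
    have habs : ∀ x ∈ T, |c x + t * d x| = |c x| + t * ((SignType.sign (c x) : ℝ) * d x) := by
      intro x hx
      have h1 : |c x + t * d x| = |(SignType.sign (c x) : ℝ) * (c x + t * d x)| := by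
        rw [abs_mul, hsgn1 x hx, one_mul]
      have h2 : (SignType.sign (c x) : ℝ) * (c x + t * d x)
          = |c x| + t * ((SignType.sign (c x) : ℝ) * d x) := by
        rw [← hsgn x hx]; ring
      rw [h1, h2, abs_of_nonneg]
      rcases lt_or_ge ((SignType.sign (c x) : ℝ) * d x) 0 with h3 | h3
      · have h4 := hmin x (Finset.mem_filter.2 ⟨hx, h3⟩)
        have h5 : (SignType.sign (c x) : ℝ) * d x = -|d x| := by
          have h6 := abs_of_neg h3
          rw [abs_mul, hsgn1 x hx, one_mul] at h6
          linarith
        have hdpos : 0 < |d x| := by rw [h5] at h3; linarith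
        have h6 : t * |d x| ≤ |c x| := by rwa [← le_div_iff₀ hdpos]
        rw [h5]; linarith
      · positivity
    refine ⟨fun x => c x + t * d x, ?_, ?_, x₀, hx₀T, ?_⟩
    · rw [Finset.sum_congr rfl habs, Finset.sum_add_distrib, ← Finset.mul_sum]
      have := mul_nonpos_of_nonneg_of_nonpos ht0 hdσ
      linarith
    · simp only [add_smul, mul_smul, Finset.sum_add_distrib, ← Finset.smul_sum, hd0, smul_zero,
        add_zero]
    · have h1 := habs x₀ hx₀T
      have h5 : (SignType.sign (c x₀) : ℝ) * d x₀ = -|d x₀| := by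
        have h6 := abs_of_neg hx₀d
        rw [abs_mul, hsgn1 x₀ hx₀T, one_mul] at h6
        linarith
      have hdpos : 0 < |d x₀| := by rw [h5] at hx₀d; linarith
      rw [h5, ht] at h1
      have h7 : |c x₀| / |d x₀| * -|d x₀| = -|c x₀| := by field_simp
      rw [h7, add_neg_cancel] at h1
      exact abs_eq_zero.1 h1

/-- The vector of the values at `x` of the powers with exponents `e 0, …, e N`. -/
noncomputable def powVec (N : ℕ) (e : ℕ → ℝ) (x : ℝ) : Fin (N + 1) → ℝ := fun i => x ^ e i

lemma exists_enumeration {N : ℕ} {T : Finset ℝ} (hT : T.card = N + 1) :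
    ∃ x : ℕ → ℝ, (∀ i ≤ N, x i ∈ T) ∧ (∀ i j, i < j → j ≤ N → x i < x j) ∧
      ∀ F : ℝ → ℝ, ∑ j ∈ Finset.range (N + 1), F (x j) = ∑ t ∈ T, F t := by
  set φ := T.orderEmbOfFin hT with hφ
  set x : ℕ → ℝ := fun i => if h : i < N + 1 then φ ⟨i, h⟩ else 0 with hx
  have hxφ : ∀ i : Fin (N + 1), x i = φ i := fun i => by simp only [hx, dif_pos i.2]
  refine ⟨x, fun i hi => ?_, fun i j hij hj => ?_, fun F => ?_⟩
  · have : x i = φ ⟨i, by omega⟩ := hxφ ⟨i, by omega⟩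
    rw [this]
    exact Finset.orderEmbOfFin_mem T hT _
  · have h1 : x i = φ ⟨i, by omega⟩ := hxφ ⟨i, by omega⟩
    have h2 : x j = φ ⟨j, by omega⟩ := hxφ ⟨j, by omega⟩
    rw [h1, h2]
    exact φ.strictMono hij
  · rw [Finset.sum_range, ← Finset.map_orderEmbOfFin_univ T hT, Finset.sum_map]
    exact Finset.sum_congr rfl fun i _ => by rw [hxφ]; rfl

/-- Small vectors are combinations of the power vectors of given points with small coefficients. -/
lemma exists_small_combination {N : ℕ} {g : ℕ → ℝ} (hg : StrictMono g) {Z : Finset ℝ}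
    (hZ : Z.card = N + 1) (hpos : ∀ x ∈ Z, 0 < x) :
    ∃ ε > 0, ∀ u : Fin (N + 1) → ℝ, ‖u‖ < ε → ∃ c : ℝ → ℝ, (∀ x ∉ Z, c x = 0) ∧
      ∑ x ∈ Z, |c x| ≤ 1 ∧ ∑ x ∈ Z, c x • powVec N g x = u := by
  obtain ⟨x, hxZ, hxmono, -⟩ := exists_enumeration hZ
  set L : (Z → ℝ) →ₗ[ℝ] (Fin (N + 1) → ℝ) := Fintype.linearCombination ℝ fun t : Z => powVec N g t
    with hL
  have hsurj : Function.Surjective L := by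
    intro w
    obtain ⟨a, ha⟩ := Matrix.vecMul_surjective_iff_isUnit.2
      (isUnit_muntz_matrix (N := N) hg (fun i hi => hpos _ (hxZ i hi)) hxmono) w
    have hw : w = ∑ i : Fin (N + 1), a i • powVec N g (x i) := by
      rw [← ha]
      funext k
      simp [Matrix.vecMul, dotProduct, powVec, Finset.sum_apply]
    have hmem : w ∈ LinearMap.range L := by
      rw [hw]
      refine Submodule.sum_mem _ fun i _ => Submodule.smul_mem _ _ ?_
      refine ⟨Pi.single ⟨x i, hxZ i (by omega)⟩ 1, ?_⟩
      simp [hL, Fintype.linearCombination_apply_single]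
    exact hmem
  have hopen := (L.isOpenMap_of_finiteDimensional hsurj) {d : Z → ℝ | ∑ t, |d t| < 1}
    (isOpen_lt (by fun_prop) continuous_const)
  obtain ⟨ε, hε, hball⟩ := Metric.isOpen_iff.1 hopen 0 ⟨0, by simp, map_zero L⟩
  refine ⟨ε, hε, fun u hu => ?_⟩
  obtain ⟨d, hd, rfl⟩ := hball (mem_ball_zero_iff.2 hu)
  refine ⟨fun t => if h : t ∈ Z then d ⟨t, h⟩ else 0, fun t ht => by simp [ht], ?_, ?_⟩
  · rw [← Finset.sum_coe_sort]
    refine le_trans (le_of_eq ?_) (le_of_lt hd)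
    exact Finset.sum_congr rfl fun t _ => by simp
  · rw [← Finset.sum_coe_sort, hL, Fintype.linearCombination_apply]
    exact Finset.sum_congr rfl fun t _ => by simp

/-- A bound for the value at `y` gives a representation with bounded coefficients. -/
lemma exists_combination_of_bound {N : ℕ} {g : ℕ → ℝ} (hg : StrictMono g) {K : Set ℝ}
    (hKinf : K.Infinite) (hpos : ∀ x ∈ K, 0 < x) {y C : ℝ} (hC : 0 < C)
    (H : ∀ (a : ℕ → ℝ) (b : ℝ), (∀ x ∈ K, |muntzSum (N + 1) a g x| ≤ b) →
      |muntzSum (N + 1) a g y| ≤ C * b) :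
    ∃ (T : Finset ℝ) (c : ℝ → ℝ), (T : Set ℝ) ⊆ K ∧ ∑ x ∈ T, |c x| ≤ 2 * C ∧
      ∑ x ∈ T, c x • powVec N g x = powVec N g y := by
  set S : Set (Fin (N + 1) → ℝ) := powVec N g '' K ∪ (fun x => -powVec N g x) '' K with hS
  -- A functional separating the point from the hull is a generalized polynomial bounded on `K` by
  -- `u` and larger than `C * u` at `y`, against `H`.
  have hmem : C⁻¹ • powVec N g y ∈ closure (convexHull ℝ S) := by
    by_contra hcon
    obtain ⟨f, u, hfu, huf⟩ := geometric_hahn_banach_closed_point (convex_convexHull ℝ S).closure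
      isClosed_closure hcon
    set a : ℕ → ℝ := fun i => if h : i < N + 1 then f (Pi.single ⟨i, h⟩ 1) else 0 with ha
    have hf : ∀ x, f (powVec N g x) = muntzSum (N + 1) a g x := by
      intro x
      rw [muntzSum_eq_sum_fin]
      have h1 := LinearMap.pi_apply_eq_sum_univ (f : (Fin (N + 1) → ℝ) →ₗ[ℝ] ℝ) (powVec N g x)
      refine h1.trans (Finset.sum_congr rfl fun i _ => ?_)
      simp only [ha, dif_pos i.2, smul_eq_mul, powVec]
      rw [mul_comm]
      congr 1
      refine congrArg f ?_
      funext j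
      simp [Pi.single_apply, eq_comm]
    have h1 : ∀ x ∈ K, |muntzSum (N + 1) a g x| ≤ u := by
      intro x hx
      rw [← hf, abs_le]
      have h2 := hfu _ (subset_closure (subset_convexHull ℝ S (Or.inl ⟨x, hx, rfl⟩)))
      have h3 := hfu _ (subset_closure (subset_convexHull ℝ S (Or.inr ⟨x, hx, rfl⟩)))
      rw [map_neg] at h3
      exact ⟨by linarith, h2.le⟩
    have h2 := H a u h1
    rw [map_smul, smul_eq_mul, hf] at huf
    have h3 : C * u < muntzSum (N + 1) a g y := by
      rw [inv_mul_eq_div, lt_div_iff₀ hC] at huf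
      linarith
    have := le_abs_self (muntzSum (N + 1) a g y)
    linarith
  -- the combinations with small coefficients form a convex set
  set Q : Set (Fin (N + 1) → ℝ) := {w | ∃ (T : Finset ℝ) (c : ℝ → ℝ), (T : Set ℝ) ⊆ K ∧
    (∀ x ∉ T, c x = 0) ∧ ∑ x ∈ T, |c x| ≤ 1 ∧ ∑ x ∈ T, c x • powVec N g x = w} with hQ
  have hQconv : Convex ℝ Q := by
    rintro w₁ ⟨T₁, c₁, hT₁, h₁, hs₁, rfl⟩ w₂ ⟨T₂, c₂, hT₂, h₂, hs₂, rfl⟩ α β hα hβ hαβ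
    have e1 : ∀ {M : Type} [AddCommMonoid M] (F : ℝ → M), (∀ x ∉ T₁, F x = 0) →
        ∑ x ∈ T₁ ∪ T₂, F x = ∑ x ∈ T₁, F x := fun F hF =>
      (Finset.sum_subset Finset.subset_union_left fun x _ hx => hF x hx).symm
    have e2 : ∀ {M : Type} [AddCommMonoid M] (F : ℝ → M), (∀ x ∉ T₂, F x = 0) →
        ∑ x ∈ T₁ ∪ T₂, F x = ∑ x ∈ T₂, F x := fun F hF =>
      (Finset.sum_subset Finset.subset_union_right fun x _ hx => hF x hx).symm
    refine ⟨T₁ ∪ T₂, fun x => α * c₁ x + β * c₂ x, ?_, ?_, ?_, ?_⟩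
    · rw [Finset.coe_union]; exact Set.union_subset hT₁ hT₂
    · intro x hx
      rw [Finset.notMem_union] at hx
      simp [h₁ x hx.1, h₂ x hx.2]
    · calc ∑ x ∈ T₁ ∪ T₂, |α * c₁ x + β * c₂ x|
          ≤ ∑ x ∈ T₁ ∪ T₂, (α * |c₁ x| + β * |c₂ x|) := by
            refine Finset.sum_le_sum fun x _ => (abs_add_le _ _).trans ?_
            rw [abs_mul, abs_mul, abs_of_nonneg hα, abs_of_nonneg hβ]
        _ = α * ∑ x ∈ T₁, |c₁ x| + β * ∑ x ∈ T₂, |c₂ x| := by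
            rw [Finset.sum_add_distrib, ← Finset.mul_sum, ← Finset.mul_sum,
              e1 _ (fun x hx => by rw [h₁ x hx, abs_zero]),
              e2 _ (fun x hx => by rw [h₂ x hx, abs_zero])]
        _ ≤ α * 1 + β * 1 := by gcongr
        _ = 1 := by rw [mul_one, mul_one, hαβ]
    · simp only [add_smul, mul_smul, Finset.sum_add_distrib, ← Finset.smul_sum]
      rw [e1 _ (fun x hx => by rw [h₁ x hx, zero_smul]),
        e2 _ (fun x hx => by rw [h₂ x hx, zero_smul])]
  have hSQ : S ⊆ Q := by
    rintro w (⟨x, hx, rfl⟩ | ⟨x, hx, rfl⟩)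
    · exact ⟨{x}, fun t => if t = x then 1 else 0, by simpa using hx, by simp, by simp, by simp⟩
    · exact ⟨{x}, fun t => if t = x then -1 else 0, by simpa using hx, by simp, by simp, by simp⟩
  -- The closure is removed by correcting the approximation error with `N + 1` points of `K`.
  -- Averaging the approximant and the correction keeps the coefficients in the convex set `Q` and
  -- costs the factor `2`.
  obtain ⟨Z, hZK, hZ⟩ := hKinf.exists_subset_card_eq (N + 1)
  obtain ⟨ε, hε, hsmall⟩ := exists_small_combination hg hZ fun x hx => hpos x (hZK hx)
  obtain ⟨q, hq, hqd⟩ := Metric.mem_closure_iff.1 hmem ε hε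
  rw [dist_eq_norm] at hqd
  obtain ⟨c₀, hc₀, hs₀, hsum₀⟩ := hsmall _ hqd
  obtain ⟨T, c, hT, -, hs, hsum⟩ := hQconv (convexHull_min hSQ hQconv hq)
    (show C⁻¹ • powVec N g y - q ∈ Q from ⟨Z, c₀, hZK, hc₀, hs₀, hsum₀⟩)
    (by norm_num : (0 : ℝ) ≤ 1 / 2) (by norm_num : (0 : ℝ) ≤ 1 / 2) (by norm_num)
  refine ⟨T, fun x => 2 * C * c x, hT, ?_, ?_⟩
  · simp only [abs_mul, abs_of_pos hC, abs_two, ← Finset.mul_sum]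
    nlinarith
  · simp only [mul_smul, ← Finset.smul_sum, hsum]
    rw [← smul_add, add_sub_cancel, smul_smul, smul_smul, smul_smul]
    have : 2 * C * (1 / 2) * C⁻¹ = 1 := by field_simp
    rw [this, one_smul]

/-- A bound to the left of an infinite set persists when the exponents are replaced by larger
ones. -/
lemma bound_of_exp_le {N : ℕ} {g e : ℕ → ℝ} (hg : StrictMono g) (he : StrictMono e)
    (hle : ∀ i, g i ≤ e i) {y C : ℝ} (hy : 0 < y) (hC : 0 < C) {K : Set ℝ}
    (hKinf : K.Infinite) (hyK : ∀ x ∈ K, y < x)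
    (H : ∀ (a : ℕ → ℝ) (b : ℝ), (∀ x ∈ K, |muntzSum (N + 1) a g x| ≤ b) →
      |muntzSum (N + 1) a g y| ≤ C * b)
    (a : ℕ → ℝ) (b : ℝ) (hb : ∀ x ∈ K, |muntzSum (N + 1) a e x| ≤ b) :
    |muntzSum (N + 1) a e y| ≤ 2 * C * b := by
  classical
  obtain ⟨T₀, c₀, hT₀, hs₀, hsum₀⟩ := exists_combination_of_bound hg hKinf
    (fun x hx => hy.trans (hyK x hx)) hC H
  obtain ⟨T₁, hT₁, c₁, hcard, hs₁, hsum₁⟩ := exists_card_le_finrank (powVec N g) _ T₀ c₀ rfl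
  rw [Module.finrank_fin_fun] at hcard
  -- Extra points with coefficient zero complete the support to exactly `N + 1` nodes, so that the
  -- coefficients are weights and the monotonicity in the exponents applies.
  obtain ⟨T₂, hT₂, hcard₂⟩ := (hKinf.sdiff T₁.finite_toSet).exists_subset_card_eq (N + 1 - T₁.card)
  have hdisj : Disjoint T₁ T₂ := by
    rw [Finset.disjoint_left]
    exact fun x h1 h2 => (hT₂ h2).2 h1
  set T := T₁ ∪ T₂ with hT
  have hTcard : T.card = N + 1 := by rw [hT, Finset.card_union_of_disjoint hdisj, hcard₂]; omega
  have hTK : ∀ x ∈ T, x ∈ K := by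
    intro x hx
    rcases Finset.mem_union.1 hx with h | h
    · exact hT₀ (hT₁ h)
    · exact (hT₂ h).1
  set c : ℝ → ℝ := fun x => if x ∈ T₁ then c₁ x else 0 with hc
  have hcsum : ∀ F : ℝ → ℝ → ℝ, (∀ x, F x 0 = 0) →
      ∑ x ∈ T, F x (c x) = ∑ x ∈ T₁, F x (c₁ x) := by
    intro F hF
    rw [hT, Finset.sum_union hdisj, Finset.sum_eq_zero (s := T₂), add_zero]
    · exact Finset.sum_congr rfl fun x hx => by simp [hc, hx]
    · intro x hx
      have : x ∉ T₁ := fun h => Finset.disjoint_left.1 hdisj h hx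
      simp [hc, this, hF]
  obtain ⟨x, hxT, hxmono, hreindex⟩ := exists_enumeration hTcard
  have hyx : y < x 0 := hyK _ (hTK _ (hxT 0 (Nat.zero_le _)))
  have hv : IsWeights N g x y fun j => c (x j) := by
    intro i hi
    rw [hreindex fun t => c t * t ^ g i, hcsum (fun t r => r * t ^ g i) (fun t => zero_mul _)]
    have h1 := congrFun (hsum₁.trans hsum₀) ⟨i, by omega⟩
    simpa [powVec, Finset.sum_apply] using h1
  obtain ⟨w, hw⟩ := exists_isWeights he
    (fun i hi => hy.trans (hyK _ (hTK _ (hxT i hi)))) hxmono y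
  have hb0 : 0 ≤ b := (abs_nonneg _).trans (hb _ (hTK _ (hxT 0 (Nat.zero_le _))))
  rw [hw.muntzSum_eq a]
  calc |∑ j ∈ Finset.range (N + 1), w j * muntzSum (N + 1) a e (x j)|
      ≤ ∑ j ∈ Finset.range (N + 1), |c (x j)| * b := by
        refine (Finset.abs_sum_le_sum_abs _ _).trans (Finset.sum_le_sum fun j hj => ?_)
        have hj' : j ≤ N := by have := Finset.mem_range.1 hj; omega
        rw [abs_mul]
        exact mul_le_mul (hw.abs_le_of_exp_le he hg hle hxmono hy hyx hv hj')
          (hb _ (hTK _ (hxT j hj'))) (abs_nonneg _) (abs_nonneg _)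
    _ = (∑ t ∈ T₁, |c₁ t|) * b := by
        rw [hreindex fun t => |c t| * b, hcsum (fun _ r => |r| * b) (fun _ => by simp),
          Finset.sum_mul]
    _ ≤ 2 * C * b := mul_le_mul_of_nonneg_right (hs₁.trans hs₀) hb0

/-! ### Regular and linear minorants of the exponents -/

lemma sum_one_div_sqrt_le (m : ℕ) : ∑ i ∈ Finset.range (m + 1), 1 / √(i : ℝ) ≤ 2 * √(m : ℝ) := by
  induction m with
  | zero => simp
  | succ m ih =>
    rw [Finset.sum_range_succ]
    have h1 := Real.sq_sqrt (Nat.cast_nonneg (α := ℝ) m)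
    have h2 := Real.sq_sqrt (by positivity : (0 : ℝ) ≤ ((m + 1 : ℕ) : ℝ))
    have h3 : 0 < √((m + 1 : ℕ) : ℝ) := Real.sqrt_pos.2 (by positivity)
    have h6 : 1 / √((m + 1 : ℕ) : ℝ) ≤ 2 * (√((m + 1 : ℕ) : ℝ) - √(m : ℝ)) := by
      rw [div_le_iff₀ h3]
      have : ((m + 1 : ℕ) : ℝ) = m + 1 := by push_cast; ring
      nlinarith [sq_nonneg (√((m + 1 : ℕ) : ℝ) - √(m : ℝ))]
    linarith

/-- Below a sequence with summable reciprocals there is one which in addition grows regularly. -/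
lemma exists_regular_minorant {lam : ℕ → ℝ} (hzero : lam 0 = 0) (hmono : StrictMono lam)
    (hsum : Summable fun i : ℕ => 1 / lam (i + 1)) :
    ∃ g : ℕ → ℝ, StrictMono g ∧ g 0 = 0 ∧ (∀ i, g i ≤ lam i) ∧
      (∀ i j : ℕ, i ≤ j → g i * √j ≤ g j * √i) ∧ Summable fun i => 1 / g i := by
  have hpos : ∀ i, 0 < i → 0 < lam i := fun i hi => by rw [← hzero]; exact hmono hi
  have hnn : ∀ i, 0 ≤ lam i := fun i => by rw [← hzero]; exact hmono.monotone (Nat.zero_le i)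
  have hsum' : Summable fun i : ℕ => 1 / lam i := (summable_nat_add_iff 1).1 hsum
  set u : ℕ → ℝ := fun l => 1 / (√(l : ℝ) * lam l) with hu
  have hu0 : ∀ l, 0 ≤ u l := fun l =>
    one_div_nonneg.2 (mul_nonneg (Real.sqrt_nonneg _) (hnn l))
  have hupos : ∀ l, 0 < l → 0 < u l := fun l hl => by
    have := hpos l hl
    have h2 : (0 : ℝ) < l := by exact_mod_cast hl
    simp only [hu]; positivity
  have hule : ∀ l, u l ≤ 1 / lam l := by
    intro l
    rcases Nat.eq_zero_or_pos l with h | h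
    · subst h; simp [hu, hzero]
    · have h1 := hpos l h
      have h2 : 1 ≤ √(l : ℝ) := Real.one_le_sqrt.2 (by exact_mod_cast h)
      exact one_div_le_one_div_of_le h1 (by nlinarith)
  have husum : Summable u := Summable.of_nonneg_of_le hu0 hule hsum'
  set F : ℕ → ℕ → ℝ := fun i l => if i < 2 * l then u l else 0 with hF
  have hF0 : ∀ i l, 0 ≤ F i l := fun i l => by
    simp only [hF]; split_ifs; exacts [hu0 l, le_rfl]
  have hFsum : ∀ i, Summable (F i) := fun i =>
    Summable.of_nonneg_of_le (hF0 i) (fun l => by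
      simp only [hF]; split_ifs; exacts [le_rfl, hu0 l]) husum
  -- The minorant is `√i / G i` with `G i = 2 * ∑_{2l > i} 1 / (√l * lam l)`. It is regular because
  -- `G` is nonincreasing.
  set G : ℕ → ℝ := fun i => 2 * ∑' l, F i l with hG
  have hGpos : ∀ i, 0 < G i := by
    intro i
    have h1 := (hFsum i).le_tsum (i + 1) (fun l _ => hF0 i l)
    have h2 : F i (i + 1) = u (i + 1) := by simp only [hF]; rw [if_pos (by omega)]
    have h3 := hupos (i + 1) (Nat.succ_pos i)
    simp only [hG]; linarith
  have hGanti : ∀ i j, i ≤ j → G j ≤ G i := by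
    intro i j hij
    refine mul_le_mul_of_nonneg_left ((hFsum j).tsum_le_tsum (fun l => ?_) (hFsum i)) zero_le_two
    simp only [hF]
    split_ifs with h1 h2
    · exact le_rfl
    · omega
    · exact hu0 l
    · exact le_rfl
  refine ⟨fun i => √(i : ℝ) / G i, ?_, by simp, ?_, ?_, ?_⟩
  · intro i j hij
    have h1 : √(i : ℝ) < √(j : ℝ) := Real.sqrt_lt_sqrt (Nat.cast_nonneg i) (by exact_mod_cast hij)
    exact (div_lt_div_of_pos_right h1 (hGpos i)).trans_le
      (div_le_div_of_nonneg_left (Real.sqrt_nonneg _) (hGpos j) (hGanti i j hij.le))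
  · intro i
    rcases Nat.eq_zero_or_pos i with h | h
    · subst h; simp [hzero]
    have hi : (0 : ℝ) < i := by exact_mod_cast h
    have hl := hpos i h
    have hsi := Real.sqrt_pos.2 hi
    have h1 : ∑ l ∈ Finset.Ioc (i / 2) i, F i l ≤ ∑' l, F i l :=
      (hFsum i).sum_le_tsum _ fun l _ => hF0 i l
    -- The indices in `(i / 2, i]` number at least `i / 2`, which gives `G i ≥ √i / lam i`, that is,
    -- a minorant.
    have h2 : ∀ l ∈ Finset.Ioc (i / 2) i, 1 / (√(i : ℝ) * lam i) ≤ F i l := by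
      intro l hl'
      obtain ⟨h3, h4⟩ := Finset.mem_Ioc.1 hl'
      simp only [hF, hu]
      rw [if_pos (by omega)]
      have h5 := hpos l (by omega)
      have h6 : (0 : ℝ) < l := by exact_mod_cast (by omega : 0 < l)
      refine one_div_le_one_div_of_le (by positivity) ?_
      exact mul_le_mul (Real.sqrt_le_sqrt (by exact_mod_cast h4)) (hmono.monotone h4) h5.le hsi.le
    have h3 := Finset.card_nsmul_le_sum _ _ _ h2
    rw [Nat.card_Ioc, nsmul_eq_mul] at h3
    have h4 : (i : ℝ) / 2 ≤ ((i - i / 2 : ℕ) : ℝ) := by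
      rw [div_le_iff₀ two_pos]
      exact_mod_cast (by omega : i ≤ (i - i / 2) * 2)
    have h5 : (i : ℝ) / 2 * (1 / (√(i : ℝ) * lam i)) ≤ ∑' l, F i l :=
      (mul_le_mul_of_nonneg_right h4 (by positivity)).trans (h3.trans h1)
    rw [div_le_iff₀ (hGpos i)]
    have h6 : (i : ℝ) / 2 * (1 / (√(i : ℝ) * lam i)) * (2 * lam i) = √(i : ℝ) := by
      have := Real.mul_self_sqrt hi.le
      field_simp
      nlinarith
    calc √(i : ℝ) = (i : ℝ) / 2 * (1 / (√(i : ℝ) * lam i)) * (2 * lam i) := h6.symm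
      _ ≤ (∑' l, F i l) * (2 * lam i) := mul_le_mul_of_nonneg_right h5 (by positivity)
      _ = lam i * G i := by simp only [hG]; ring
  · intro i j hij
    rw [div_mul_eq_mul_div, div_mul_eq_mul_div, mul_comm (√(j : ℝ))]
    exact div_le_div_of_nonneg_left (by positivity) (hGpos j) (hGanti i j hij)
  · refine summable_of_sum_range_le (c := 2 * ∑' l, 4 * (1 / lam l))
      (fun i => one_div_nonneg.2 (div_nonneg (Real.sqrt_nonneg _) (hGpos i).le)) fun n => ?_
    have h1 : ∀ i : ℕ, 1 / (√(i : ℝ) / G i) = 2 * ∑' l, 1 / √(i : ℝ) * F i l := by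
      intro i
      rw [tsum_mul_left, one_div_div]
      simp only [hG]; ring
    simp only [h1]
    -- After exchanging the sums, each `l` carries `∑_{i < 2l} 1 / √i ≤ 4 * √l`, which cancels the
    -- `√l` in `u l`.
    rw [← Finset.mul_sum, ← Summable.tsum_finsetSum fun i _ => (hFsum i).mul_left _]
    refine mul_le_mul_of_nonneg_left ?_ zero_le_two
    refine Summable.tsum_le_tsum (fun l => ?_) (summable_sum fun i _ => (hFsum i).mul_left _)
      (hsum'.mul_left 4)
    rcases Nat.eq_zero_or_pos l with h | h
    · subst h; simp [hF, hzero]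
    have hl : (0 : ℝ) < l := by exact_mod_cast h
    have h2 : ∑ i ∈ Finset.range n, 1 / √(i : ℝ) * F i l ≤
        ∑ i ∈ Finset.range (2 * l + 1), 1 / √(i : ℝ) * u l := by
      have h3 : ∑ i ∈ Finset.range n, 1 / √(i : ℝ) * F i l =
          ∑ i ∈ (Finset.range n).filter (fun i => i < 2 * l), 1 / √(i : ℝ) * u l := by
        rw [Finset.sum_filter]
        refine Finset.sum_congr rfl fun i _ => ?_
        simp only [hF]; split_ifs <;> simp
      rw [h3]
      refine Finset.sum_le_sum_of_subset_of_nonneg (fun i hi => ?_)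
        fun i _ _ => mul_nonneg (by positivity) (hu0 l)
      have := (Finset.mem_filter.1 hi).2
      exact Finset.mem_range.2 (by omega)
    refine h2.trans ?_
    rw [← Finset.sum_mul]
    have h4 : ∑ i ∈ Finset.range (2 * l + 1), 1 / √(i : ℝ) ≤ 4 * √(l : ℝ) := by
      refine (sum_one_div_sqrt_le (2 * l)).trans ?_
      have h5 : √((2 * l : ℕ) : ℝ) ≤ 2 * √(l : ℝ) := by
        rw [Real.sqrt_le_left (by positivity), mul_pow, Real.sq_sqrt hl.le]
        push_cast; linarith
      linarith
    refine (mul_le_mul_of_nonneg_right h4 (hu0 l)).trans (le_of_eq ?_)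
    have := Real.sqrt_pos.2 hl
    have h6 := hpos l h
    simp only [hu]; field_simp

/-- Monotonicity gives `i / g i ≤ ∑ 1 / g l = T`. The choice `c = 1 / (T + 1)` also ensures `c ≤ 1`.
-/
lemma exists_linear_minorant {g : ℕ → ℝ} (hg : StrictMono g) (hg0 : g 0 = 0)
    (hsum : Summable fun i => 1 / g i) : ∃ c : ℝ, 0 < c ∧ c ≤ 1 ∧ ∀ i : ℕ, c * i ≤ g i := by
  have hpos : ∀ i, 0 < i → 0 < g i := fun i hi => by rw [← hg0]; exact hg hi
  have hnn : ∀ i, 0 ≤ 1 / g i := fun i =>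
    one_div_nonneg.2 (by rw [← hg0]; exact hg.monotone (Nat.zero_le i))
  set T := ∑' i, 1 / g i with hT
  have hT0 : 0 ≤ T := tsum_nonneg hnn
  refine ⟨1 / (T + 1), by positivity, by rw [div_le_one (by positivity)]; linarith, fun i => ?_⟩
  rcases Nat.eq_zero_or_pos i with h | h
  · subst h; simp [hg0]
  have hgi := hpos i h
  have h1 : ∀ l ∈ Finset.Ioc 0 i, 1 / g i ≤ 1 / g l := fun l hl =>
    one_div_le_one_div_of_le (hpos l (Finset.mem_Ioc.1 hl).1)
      (hg.monotone (Finset.mem_Ioc.1 hl).2)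
  have h2 := (Finset.card_nsmul_le_sum _ _ _ h1).trans (hsum.sum_le_tsum _ fun l _ => hnn l)
  rw [Nat.card_Ioc, nsmul_eq_mul, Nat.sub_zero, mul_one_div, div_le_iff₀ hgi] at h2
  rw [one_div, inv_mul_le_iff₀ (by positivity)]
  nlinarith

/-! ### Conclusion -/

lemma exists_eq_muntzSum {lam : ℕ → ℝ} {f : ℝ → ℝ} (hf : f ∈ muntzSpace lam) :
    ∃ (N : ℕ) (a : ℕ → ℝ), ∀ x, f x = muntzSum (N + 1) a lam x := by
  obtain ⟨c, rfl⟩ := Finsupp.mem_span_range_iff_exists_finsupp.1 hf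
  refine ⟨c.support.sup id, c, fun x => ?_⟩
  rw [Finsupp.sum, Finset.sum_apply, muntzSum]
  simp only [Pi.smul_apply, smul_eq_mul]
  refine Finset.sum_subset (fun i hi => Finset.mem_range.2 (Nat.lt_succ_of_le ?_)) fun i _ hi => ?_
  · exact Finset.le_sup (f := id) hi
  · rw [Finsupp.notMem_support_iff.1 hi, zero_mul]

theorem theorem2p1 (lam : ℕ → ℝ) (hzero : lam 0 = 0) (hmono : StrictMono lam)
    (hsum : Summable fun i : ℕ => 1 / lam (i + 1)) (s : ℝ) (hs : 0 < s) :
    ∃ c : ℝ, ∀ ϱ : ℝ, 0 ≤ ϱ → ∀ A : Set ℝ, A ⊆ Set.Icc ϱ 1 →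
      ENNReal.ofReal s ≤ volume A →
      ∀ p ∈ muntzSpace lam,
        supNormOn p (Set.Icc 0 ϱ) ≤ c * supNormOn p A := by
  obtain ⟨g, hg, hg0, hle, hreg, hgsum⟩ := exists_regular_minorant hzero hmono hsum
  obtain ⟨c, hc, hc1, hcg⟩ := exists_linear_minorant hg hg0 hgsum
  obtain ⟨C, hC, hrem⟩ := remez_of_regular hg hg0 hreg hc hc1 hcg hgsum (half_pos hs)
  refine ⟨2 * (C + 1), fun ϱ hϱ A hA hvol p hp => ?_⟩
  obtain ⟨N, a, hpa⟩ := exists_eq_muntzSum hp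
  have hcont : Continuous fun x => |p x| := by
    have h1 : Continuous (muntzSum (N + 1) a lam) := by
      unfold muntzSum
      refine continuous_finsetSum _ fun i _ => continuous_const.mul (Real.continuous_rpow_const ?_)
      rw [← hzero]; exact hmono.monotone (Nat.zero_le i)
    rw [show p = muntzSum (N + 1) a lam from funext hpa]
    exact h1.abs
  set b := supNormOn p A with hb
  have hbA : ∀ x ∈ A, |p x| ≤ b := fun x hx =>
    le_csSup ((isCompact_Icc.bddAbove_image hcont.continuousOn).mono (Set.image_mono hA))
      ⟨x, hx, rfl⟩
  -- The part of `A` below `s / 2` has measure at most `s / 2`. Removing it makes the left endpoint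
  -- positive, which covers `ϱ = 0`.
  set r := max ϱ (s / 2) with hr
  have hr0 : 0 < r := lt_max_of_lt_right (by linarith)
  set K := A ∩ Set.Ici (s / 2) with hKdef
  have hKA : K ⊆ A := Set.inter_subset_left
  have hKr : K ⊆ Set.Icc r 1 := fun x hx => ⟨max_le (hA hx.1).1 hx.2, (hA hx.1).2⟩
  have hfin : volume K ≠ ⊤ := ((measure_mono hKr).trans_lt (by simp)).ne
  have hKvol : s / 2 ≤ volume.real K := by
    have h1 : A ⊆ Set.Icc 0 (s / 2) ∪ K := by
      intro x hx
      rcases le_total x (s / 2) with h | h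
      · exact Or.inl ⟨hϱ.trans (hA hx).1, h⟩
      · exact Or.inr ⟨hx, h⟩
    have h2 := hvol.trans ((measure_mono h1).trans (measure_union_le _ _))
    rw [Real.volume_Icc, ← ofReal_measureReal hfin,
      ← ENNReal.ofReal_add (by linarith) measureReal_nonneg,
      ENNReal.ofReal_le_ofReal_iff (by have := measureReal_nonneg (μ := volume) (s := K); linarith)] at h2
    linarith
  have hKinf : K.Infinite := by
    intro h
    rw [Measure.real, h.measure_zero, ENNReal.toReal_zero] at hKvol
    linarith
  have hbound : ∀ y ∈ Set.Ioo 0 r, |p y| ≤ 2 * (C + 1) * b := by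
    intro y hy
    rw [hpa]
    refine bound_of_exp_le hg hmono hle hy.1 (by linarith) hKinf
      (fun x hx => hy.2.trans_le (hKr hx).1) (fun a' b' h => ?_) a b
      (fun x hx => by rw [← hpa]; exact hbA x (hKA hx))
    obtain ⟨x, hx⟩ := hKinf.nonempty
    have hb' : 0 ≤ b' := (abs_nonneg _).trans (h x hx)
    have := hrem r hr0 K hKr hKvol (N + 1) a' b' h y hy.1 hy.2.le
    linarith
  -- The comparison of exponents needs `y` positive and strictly to the left of the nodes; the
  -- endpoints `0` and `r` follow by continuity.
  have hclosed : IsClosed {y | |p y| ≤ 2 * (C + 1) * b} := isClosed_le hcont continuous_const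
  have hIcc : Set.Icc 0 r ⊆ {y | |p y| ≤ 2 * (C + 1) * b} := by
    rw [← closure_Ioo hr0.ne]
    exact closure_minimal hbound hclosed
  refine csSup_le ⟨_, 0, ⟨le_rfl, hϱ⟩, rfl⟩ ?_
  rintro _ ⟨y, hy, rfl⟩
  exact hIcc ⟨hy.1, hy.2.trans (le_max_left _ _)⟩
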